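/- **Theorem 1.1 (well-posedness of the combinatorial Ricci flow).** Let $\mathcal T=(V,E,F)$ be an infinite disk triangulation, that is, a locally finite simplicial complex with infinite vertex set $V$, edge set $E$ and set of triangles $F$, whose underlying space is a surface without boundary that is simply connected and has exactly one end. Let $\Phi\in[0,\frac{\pi}{2}]^E$. For $r\in(0,\infty)^V$ put, for $\{i,j\}\in E$, $$l_{ij}=\sqrt{r_i^2+r_j^2+2\cos\Phi_{ij}\,r_ir_j}\ \text{ (Euclidean)},\qquad l_{ij}=\cosh^{-1}\bigl(\cosh r_i\cosh r_j+\cos\Phi_{ij}\sinh r_i\sinh r_j\bigr)\ \text{ (hyperbolic)},$$ let $\theta_i^{jk}$ be the inner angle at $i$ of the Euclidean (hyperbolic, respectively) triangle with side lengths $l_{ij},l_{jk},l_{ik}$ for $\{i,j,k\}\in F$, and let $K_i(r)=2\pi-\sum_{\{i,j,k\}\in F}\theta_i^{jk}$ be the discrete Gaussian curvature at $i\in V$, the sum running over the triangles that contain $i$. Consider the combinatorial Ricci flow $$\frac{dr_i}{dt}=-K_i(r)\,r_i\ \text{ (Euclidean)},\qquad \frac{dr_i}{dt}=-K_i(r)\sinh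 r_i\ \text{ (hyperbolic)},\qquad i\in V .$$ A solution on $[0,\infty)$ is a family $r(t)\in(0,\infty)^V$, $t\ge 0$, such that each $r_i$ is differentiable on $[0,\infty)$ (one-sidedly at $0$) and the equations hold for all $i\in V$ and $t\ge0$. Then, in either of the two geometries, for every $r_0\in(0,\infty)^V$: 1. the flow has a solution $r(t)$, $t\in[0,\infty)$, with $r(0)=r_0$; 2. if $r(t)$ and $\hat r(t)$, $t\in[0,\infty)$, are two solutions with $r(0)=\hat r(0)=r_0$ whose curvatures $K_i(r(t))$ and $K_i(\hat r(t))$ are both uniformly bounded on $V\times[0,\infty)$, then $r(t)=\hat r(t)$ for all $t\ge 0$. -/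

import Mathlib

namespace CombinatorialRicciFlow

/-- The 1-skeleton of a simplicial complex: its vertices and edges. -/
def oneSkeleton {V : Type*} (T : AbstractSimplicialComplex V) : SimpleGraph V where
  Adj i j := i ≠ j ∧ ∃ e ∈ T, (e : Set V) = {i, j}
  symm := ⟨fun i j ⟨hne, e, he, h⟩ => ⟨hne.symm, e, he, by rw [h, Set.pair_comm]⟩⟩
  loopless := ⟨fun _ h => h.1 rfl⟩

/-- The geometric realization of a simplicial complex in barycentric coordinates: the nonnegative
functions on the vertices that are supported exactly on a simplex and have total sum `1`. It
carries the topology of pointwise convergence of the coordinates; for a locally finite complex,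
the only case used below, this is the usual (weak = metric) topology. -/
abbrev Realization {V : Type*} (T : AbstractSimplicialComplex V) : Type _ :=
  {x : V → ℝ // (∀ v, 0 ≤ x v) ∧ ∃ s ∈ T, Function.support x = (s : Set V) ∧ ∑ v ∈ s, x v = 1}

/-- A disk triangulation: a locally finite triangulation of a surface without boundary which is
simply connected (in particular connected) and has exactly one end. (The realization of a
connected locally finite complex is automatically Hausdorff and second countable, and its ends are
the ends of the 1-skeleton.) -/
structure IsDiskTriangulation {V : Type*} (T : AbstractSimplicialComplex V) : Prop where
  /-- there are only vertices, edges and triangles -/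
  card_le_three : ∀ s ∈ T, s.card ≤ 3
  /-- every vertex lies in finitely many simplices -/
  locallyFinite : ∀ v : V, {s : Finset V | s ∈ T ∧ v ∈ s}.Finite
  /-- the underlying space is a topological surface -/
  surface : Nonempty (ChartedSpace (EuclideanSpace ℝ (Fin 2)) (Realization T))
  simplyConnected : SimplyConnectedSpace (Realization T)
  oneEnd : ∃! e, e ∈ (oneSkeleton T).end

/-- The two background geometries. -/
inductive Background
  | euclidean
  | hyperbolic

/-- The length `l_ij` of the edge `{i, j}` for the radii `r` and the intersection angles `Φ`. -/
noncomputable def edgeLength {V : Type*} (g : Background) (Φ : Sym2 V → ℝ) (r : V → ℝ)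
    (i j : V) : ℝ :=
  match g with
  | .euclidean => √(r i ^ 2 + r j ^ 2 + 2 * Real.cos (Φ s(i, j)) * r i * r j)
  | .hyperbolic => Real.arcosh (Real.cosh (r i) * Real.cosh (r j) +
      Real.cos (Φ s(i, j)) * Real.sinh (r i) * Real.sinh (r j))

/-- The angle enclosed by the sides `a`, `b` and opposite to the side `c` in a triangle of the
background geometry with side lengths `a`, `b`, `c` (laws of cosines). -/
noncomputable def triangleAngle (g : Background) (a b c : ℝ) : ℝ :=
  match g with
  | .euclidean => Real.arccos ((a ^ 2 + b ^ 2 - c ^ 2) / (2 * a * b))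
  | .hyperbolic => Real.arccos
      ((Real.cosh a * Real.cosh b - Real.cosh c) / (Real.sinh a * Real.sinh b))

/-- The inner angle `θ_i^{jk}` at the vertex `i` of the triangle `{i, j, k}`. -/
noncomputable def innerAngle {V : Type*} (g : Background) (Φ : Sym2 V → ℝ) (r : V → ℝ)
    (i j k : V) : ℝ :=
  triangleAngle g (edgeLength g Φ r i j) (edgeLength g Φ r i k) (edgeLength g Φ r j k)

theorem edgeLength_comm {V : Type*} (g : Background) (Φ : Sym2 V → ℝ) (r : V → ℝ) (i j : V) :
    edgeLength g Φ r i j = edgeLength g Φ r j i := by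
  cases g <;> simp only [edgeLength, Sym2.eq_swap (a := i) (b := j)] <;> congr 1 <;> ring

theorem triangleAngle_comm (g : Background) (a b c : ℝ) :
    triangleAngle g a b c = triangleAngle g b a c := by
  cases g <;> simp only [triangleAngle] <;> congr 2 <;> ring

theorem innerAngle_comm {V : Type*} (g : Background) (Φ : Sym2 V → ℝ) (r : V → ℝ) (i j k : V) :
    innerAngle g Φ r i j k = innerAngle g Φ r i k j := by
  simp only [innerAngle]
  rw [triangleAngle_comm, edgeLength_comm g Φ r j k]

/-- The edges `{j, k}` opposite to the vertex `i` in the faces `{i, j, k}` at `i`. They correspond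
one to one to the faces that contain `i`. -/
def oppositeEdges {V : Type*} (T : AbstractSimplicialComplex V) (i : V) : Set (Sym2 V) :=
  {e | ∃ j k : V, e = s(j, k) ∧ i ≠ j ∧ i ≠ k ∧ j ≠ k ∧ ∃ f ∈ T, (f : Set V) = {i, j, k}}

/-- The discrete Gaussian curvature `K_i = 2π - ∑ θ_i^{jk}`, the sum being over the faces
`{i, j, k}` at `i` (a finite sum, if the complex is locally finite). -/
noncomputable def curvature {V : Type*} (g : Background) (T : AbstractSimplicialComplex V)
    (Φ : Sym2 V → ℝ) (r : V → ℝ) (i : V) : ℝ :=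
  2 * Real.pi - ∑ᶠ e ∈ oppositeEdges T i,
    Sym2.lift ⟨fun j k => innerAngle g Φ r i j k, innerAngle_comm g Φ r i⟩ e

/-- The factor of `-K_i` in the flow: `r_i` in Euclidean and `sinh r_i` in hyperbolic background
geometry. -/
noncomputable def flowFactor (g : Background) (x : ℝ) : ℝ :=
  match g with
  | .euclidean => x
  | .hyperbolic => Real.sinh x

/-- `r t i`, `0 ≤ t`, is a solution on `[0, ∞)` of the combinatorial Ricci flow: all `r t` are
circle-packing metrics, and `dr_i/dt = -K_i r_i` (Euclidean) or `dr_i/dt = -K_i sinh r_i`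
(hyperbolic) for all `t ≥ 0`, the derivative being one-sided at `t = 0`. -/
structure IsSolution {V : Type*} (g : Background) (T : AbstractSimplicialComplex V)
    (Φ : Sym2 V → ℝ) (r : ℝ → V → ℝ) : Prop where
  pos : ∀ t, 0 ≤ t → ∀ i, 0 < r t i
  flow : ∀ t, 0 ≤ t → ∀ i, HasDerivWithinAt (fun s => r s i)
    (-curvature g T Φ (r t) i * flowFactor g (r t i)) (Set.Ici 0) t

/-- The curvatures of `r` are uniformly bounded on `V × [0, ∞)`. -/
def BoundedCurvature {V : Type*} (g : Background) (T : AbstractSimplicialComplex V)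
    (Φ : Sym2 V → ℝ) (r : ℝ → V → ℝ) : Prop :=
  ∃ M : ℝ, ∀ t, 0 ≤ t → ∀ i, |curvature g T Φ (r t) i| ≤ M

end CombinatorialRicciFlow

namespace CombinatorialRicciFlow

/-! In the coordinate `u` with `du/dr = 1 / flowFactor` (`radCoord`) both flows read `du/dt = -K`.
Local finiteness makes each `K_i` a function of finitely many radii with a bound depending on the
number of faces at `i`. That number need not be bounded over `V`, so neither existence nor
uniqueness can rest on a Lipschitz estimate that counts faces.

Existence comes from a Peano theorem in the product topology
(`exists_hasDerivWithinAt_of_continuous`). In Euclidean geometry it applies directly to `log r`. In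
hyperbolic geometry a radius must be kept from reaching infinity in finite time: `K_i > 0` as soon
as `r_i` is large, whatever the other radii are (`eventually_curvature_pos`), so large radii act as
barriers and the vector field can be truncated there.

For uniqueness let `F` bound `|u - u'|` over all vertices, and take a vertex with `u_i ≥ u'_i`. Its
angles decrease in its own radius (`cotAngle_le_of_le`). In the parameter `x` of an adjacent radius
an angle `θ` satisfies `|x ∂θ/∂x| ≤ 3 sin θ ≤ 3 θ`, a Harnack inequality (`cotAngle_le_mul`), so the
two adjacent radii change it by a factor of at most `exp (6 F)`. A multiplicative estimate sums over
the faces without counting them: `K'_i - K_i ≤ (exp (6 F) - 1) (2π - K'_i)`, which bounded curvature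
turns into a constant times `F` (`curvature_sub_le`). This one-sided bound suffices for a Gronwall
argument over infinitely many vertices (`eq_zero_of_deriv_le_mul_sup`). -/

/-! ### The angle of a triangle of circles, in coordinates common to both geometries -/

/-- The numerator of the cotangent of the angle at `i`. Here `κ` is `0` in Euclidean and `1` in
hyperbolic geometry, `p`, `q`, `s` are the cosines of `Φ_ij`, `Φ_ik`, `Φ_jk`, the pair `(A, B)` is
`(r_i ^ 2, r_i)` or `(sinh r_i ^ 2, sinh r_i * cosh r_i)`, and `x`, `y` are the radii at `j`, `k` or
their hyperbolic tangents. -/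
def cotNum (κ p q s A B x y : ℝ) : ℝ :=
  A + B * (p * x + q * y) + (κ * p * q * A - s) * (x * y)

/-- The square of the denominator of the cotangent of the angle at `i`, see `cotNum`. -/
def cotDen (κ p q s A B x y : ℝ) : ℝ :=
  A * ((1 - p ^ 2) * x ^ 2 + (1 - q ^ 2) * y ^ 2 + 2 * (s + p * q) * (x * y) +
      κ * (p ^ 2 + q ^ 2 + 2 * p * q * s) * (x * y) ^ 2) +
    B * (2 * (x * y) * ((q + p * s) * x + (p + q * s) * y)) + (1 - s ^ 2) * (x * y) ^ 2

/-- The angle at `i`, see `cotNum`. -/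
noncomputable def cotAngle (κ p q s A B x y : ℝ) : ℝ :=
  Real.pi / 2 - Real.arctan (cotNum κ p q s A B x y / √(cotDen κ p q s A B x y))

section cotAngle

variable {κ p q s A B x y : ℝ}

theorem cotNum_comm : cotNum κ p q s A B x y = cotNum κ q p s A B y x := by
  unfold cotNum; ring

theorem cotDen_comm : cotDen κ p q s A B x y = cotDen κ q p s A B y x := by
  unfold cotDen; ring

theorem cotAngle_comm : cotAngle κ p q s A B x y = cotAngle κ q p s A B y x := by
  rw [cotAngle, cotAngle, cotNum_comm, cotDen_comm]

/-- The two factors are, up to normalization by `cosh`, the squares of the lengths (or of their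
`sinh`) of the sides at `i`. Hence the law of cosines reads `cos θ = N / √(N² + D)`, that is `cot θ
= N / √D`. -/
theorem cotNum_sq_add_cotDen (hB : B ^ 2 = A * (1 + κ * A)) :
    cotNum κ p q s A B x y ^ 2 + cotDen κ p q s A B x y =
      (A + 2 * p * B * x + κ * p ^ 2 * A * x ^ 2 + x ^ 2) *
        (A + 2 * q * B * y + κ * q ^ 2 * A * y ^ 2 + y ^ 2) := by
  unfold cotNum cotDen
  linear_combination ((p * x + q * y) ^ 2 - 4 * p * q * x * y) * hB

theorem cotAngle_pos : 0 < cotAngle κ p q s A B x y := by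
  have := Real.arctan_lt_pi_div_two (cotNum κ p q s A B x y / √(cotDen κ p q s A B x y))
  unfold cotAngle; linarith

theorem cotDen_pos (hκ : 0 ≤ κ) (hp : p ∈ Set.Icc 0 1) (hq : q ∈ Set.Icc 0 1)
    (hs : s ∈ Set.Icc 0 1) (hA : 0 < A) (hB : 0 < B) (hx : 0 < x) (hy : 0 < y) :
    0 < cotDen κ p q s A B x y := by
  obtain ⟨hp0, hp1⟩ := hp
  obtain ⟨hq0, hq1⟩ := hq
  obtain ⟨hs0, hs1⟩ := hs
  have h1 : 0 ≤ 1 - p ^ 2 := by nlinarith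
  have h2 : 0 ≤ 1 - q ^ 2 := by nlinarith
  have h3 : 0 ≤ 1 - s ^ 2 := by nlinarith
  unfold cotDen
  -- For `p < 1` the term in `x ^ 2` is positive; for `p = 1` the coefficient `p + q * s ≥ 1` makes
  -- the `B` term positive.
  rcases hp1.lt_or_eq with h | rfl
  · have h1 : 0 < 1 - p ^ 2 := by nlinarith
    positivity
  · positivity

/-- The angle at a vertex decreases in the radius at the vertex. -/
theorem cotAngle_le_of_le {A' B' : ℝ} (hκ : 0 ≤ κ) (hp : p ∈ Set.Icc 0 1) (hq : q ∈ Set.Icc 0 1)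
    (hs : s ∈ Set.Icc 0 1) (hx : 0 < x) (hy : 0 < y) (hA : 0 < A) (hB : 0 < B)
    (hBA : B ^ 2 = A * (1 + κ * A)) (hBA' : B' ^ 2 = A' * (1 + κ * A')) (hAA' : A ≤ A')
    (hBB' : B ≤ B') :
    cotAngle κ p q s A' B' x y ≤ cotAngle κ p q s A B x y := by
  have hD := cotDen_pos hκ hp hq hs hA hB hx hy
  have hD' := cotDen_pos hκ hp hq hs (hA.trans_le hAA') (hB.trans_le hBB') hx hy
  have hA' := hA.trans_le hAA'
  have hB' := hB.trans_le hBB'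
  obtain ⟨hp0, hp1⟩ := hp
  obtain ⟨hq0, hq1⟩ := hq
  obtain ⟨hs0, hs1⟩ := hs
  have h1 : 0 ≤ 1 - p ^ 2 := by nlinarith
  have h2 : 0 ≤ 1 - q ^ 2 := by nlinarith
  have h3 : 0 ≤ 1 - s ^ 2 := by nlinarith
  refine sub_le_sub_left (Real.arctan_mono ?_) _
  have hsq : 0 < √(cotDen κ p q s A B x y) := Real.sqrt_pos.2 hD
  have hsq' : 0 < √(cotDen κ p q s A' B' x y) := Real.sqrt_pos.2 hD'
  have hN : cotNum κ p q s A B x y ≤ cotNum κ p q s A' B' x y := by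
    unfold cotNum
    have : (κ * p * q) * (x * y) * A ≤ (κ * p * q) * (x * y) * A' := by gcongr
    have : B * (p * x + q * y) ≤ B' * (p * x + q * y) := by gcongr
    nlinarith
  have hDD : cotDen κ p q s A B x y ≤ cotDen κ p q s A' B' x y := by
    unfold cotDen; gcongr
  -- Numerator and denominator both grow. If the numerator is nonpositive, both effects raise the
  -- quotient; otherwise their growth rates have to be compared.
  rcases le_or_gt (cotNum κ p q s A B x y) 0 with h0 | h0
  · calc cotNum κ p q s A B x y / √(cotDen κ p q s A B x y)
        ≤ cotNum κ p q s A B x y / √(cotDen κ p q s A' B' x y) :=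
          by
          rw [div_le_div_iff₀ hsq hsq']
          exact mul_le_mul_of_nonpos_left (Real.sqrt_le_sqrt hDD) h0
      _ ≤ _ := by gcongr
  -- With `μ = B' / B`, monotonicity of `A / B` and of `B ^ 2 / A = 1 + κ * A` gives `μ * A ≤ A' ≤ μ
  -- ^ 2 * A`. So the numerator grows at least by the factor `μ` and `√D` at most by `μ`.
  · have hμ : 1 ≤ B' / B := (one_le_div hB).2 hBB'
    set μ := B' / B with hμd
    have hB'e : B' = μ * B := by rw [hμd]; field_simp
    have hA1 : μ * A ≤ A' := by
      rw [hμd, div_mul_eq_mul_div, div_le_iff₀ hB]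
      refine (sq_le_sq₀ (by positivity) (by positivity)).1 ?_
      rw [mul_pow, mul_pow, hBA, hBA']
      have : 0 ≤ A * A' * (A' - A) := by
        have := sub_nonneg.2 hAA'
        positivity
      nlinarith
    have hA2 : A' ≤ μ ^ 2 * A := by
      rw [hμd, div_pow, div_mul_eq_mul_div, le_div_iff₀ (by positivity), hBA, hBA']
      have : 0 ≤ κ * A * A' * (A' - A) := by
        have := sub_nonneg.2 hAA'
        positivity
      nlinarith
    clear_value μ
    have hN2 : μ * cotNum κ p q s A B x y ≤ cotNum κ p q s A' B' x y := by
      unfold cotNum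
      rw [hB'e]
      have e1 : (1 + κ * p * q * (x * y)) * (μ * A) ≤ (1 + κ * p * q * (x * y)) * A' := by gcongr
      have e2 : 0 ≤ (μ - 1) * (s * (x * y)) :=
        mul_nonneg (sub_nonneg.2 hμ) (by positivity)
      nlinarith
    have hD2 : cotDen κ p q s A' B' x y ≤ μ ^ 2 * cotDen κ p q s A B x y := by
      calc cotDen κ p q s A' B' x y ≤ cotDen κ p q s (μ ^ 2 * A) (μ ^ 2 * B) x y := by
            have hB2 : B' ≤ μ ^ 2 * B := by rw [hB'e]; nlinarith
            unfold cotDen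
            exact add_le_add_left (add_le_add (mul_le_mul_of_nonneg_right hA2 (by positivity))
              (mul_le_mul_of_nonneg_right hB2 (by positivity))) _
        _ ≤ _ := by
            unfold cotDen
            have : (1 - s ^ 2) * (x * y) ^ 2 ≤ μ ^ 2 * ((1 - s ^ 2) * (x * y) ^ 2) :=
              le_mul_of_one_le_left (by positivity) (one_le_pow₀ hμ)
            linarith
    have hD3 : √(cotDen κ p q s A' B' x y) ≤ μ * √(cotDen κ p q s A B x y) := by
      rw [Real.sqrt_le_left (by positivity), mul_pow, Real.sq_sqrt hD.le]
      exact hD2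
    rw [div_le_div_iff₀ hsq hsq']
    calc _ ≤ cotNum κ p q s A B x y * (μ * √(cotDen κ p q s A B x y)) := by gcongr
      _ = μ * cotNum κ p q s A B x y * √(cotDen κ p q s A B x y) := by ring
      _ ≤ _ := by gcongr

/-- The left side is `|x θ'|` as the chain rule produces it. With `w = N / √D = cot θ` one has `sin
θ = 1 / √(1 + w ^ 2)`; the variation of `N` contributes at most `2 sin θ` and that of `D` at most
`sin θ`. -/
theorem abs_mul_deriv_arctan_div_sqrt_le {N D N' D' x : ℝ} (hD : 0 < D)
    (hN' : |x * N'| ≤ 2 * √(N ^ 2 + D)) (hD0 : 0 ≤ x * D') (hD' : x * D' ≤ 2 * D) :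
    |x * -(1 / (1 + (N / √D) ^ 2) * ((N' * √D - N * (D' / (2 * √D))) / √D ^ 2))| ≤
      3 * (1 / √(1 + (N / √D) ^ 2)) := by
  have hRpos : 0 < √D := Real.sqrt_pos.2 hD
  have hRsq : √D ^ 2 = D := Real.sq_sqrt hD.le
  generalize √D = R at *
  obtain ⟨w, rfl⟩ : ∃ w, N = w * R := ⟨N / R, by field_simp⟩
  rw [mul_div_cancel_right₀ w hRpos.ne']
  have hPR : √((w * R) ^ 2 + D) = √(1 + w ^ 2) * R := by
    rw [← hRsq, ← Real.sqrt_sq hRpos.le, ← Real.sqrt_mul (by positivity), Real.sqrt_sq hRpos.le]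
    congr 1
    ring
  rw [hPR] at hN'
  have hQpos : 0 < √(1 + w ^ 2) := Real.sqrt_pos.2 (by positivity)
  have hQsq : √(1 + w ^ 2) ^ 2 = 1 + w ^ 2 := Real.sq_sqrt (by positivity)
  have hwQ : |w| ≤ √(1 + w ^ 2) := Real.abs_le_sqrt (by linarith)
  generalize √(1 + w ^ 2) = Q at *
  rw [← hQsq]
  have e : x * -(1 / Q ^ 2 * ((N' * R - w * R * (D' / (2 * R))) / R ^ 2)) =
      -(x * N' / R - w * (x * D' / (2 * R ^ 2))) / Q ^ 2 := by
    have : (N' * R - w * R * (D' / (2 * R))) / R ^ 2 = N' / R - w * D' / (2 * R ^ 2) := by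
      rw [sub_div]
      congr 1 <;> field_simp
    rw [this]
    ring
  have t1 : |x * N' / R| ≤ 2 * Q := by
    rw [abs_div, abs_of_pos hRpos, div_le_iff₀ hRpos]
    linarith
  have t2 : |w * (x * D' / (2 * R ^ 2))| ≤ Q := by
    rw [abs_mul]
    have : |x * D' / (2 * R ^ 2)| ≤ 1 := by
      rw [abs_of_nonneg (by positivity), div_le_one (by positivity), hRsq]
      exact hD'
    calc |w| * |x * D' / (2 * R ^ 2)| ≤ Q * 1 := by gcongr
      _ = Q := mul_one _
  have t3 := abs_sub (x * N' / R) (w * (x * D' / (2 * R ^ 2)))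
  rw [e, abs_div, abs_neg, abs_of_pos (pow_pos hQpos 2)]
  calc _ ≤ 3 * Q / Q ^ 2 := by gcongr; linarith
    _ = 3 * (1 / Q) := by field_simp

/-- The logarithmic derivative of the angle in the radius at an adjacent vertex is bounded. -/
theorem exists_hasDerivAt_cotAngle (hκ : 0 ≤ κ) (hp : p ∈ Set.Icc 0 1) (hq : q ∈ Set.Icc 0 1)
    (hs : s ∈ Set.Icc 0 1) (hA : 0 < A) (hB : 0 < B) (hBA : B ^ 2 = A * (1 + κ * A))
    (hx : 0 < x) (hy : 0 < y) :
    ∃ d, HasDerivAt (fun x => cotAngle κ p q s A B x y) d x ∧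
      |x * d| ≤ 3 * cotAngle κ p q s A B x y := by
  have hD := cotDen_pos hκ hp hq hs hA hB hx hy
  have hP := cotNum_sq_add_cotDen (p := p) (q := q) (s := s) (x := x) (y := y) hBA
  obtain ⟨hp0, hp1⟩ := hp
  obtain ⟨hq0, hq1⟩ := hq
  obtain ⟨hs0, hs1⟩ := hs
  have h1 : 0 ≤ 1 - p ^ 2 := by nlinarith
  have h2 : 0 ≤ 1 - q ^ 2 := by nlinarith
  have h3 : 0 ≤ 1 - s ^ 2 := by nlinarith
  set N := cotNum κ p q s A B x y with hN
  set D := cotDen κ p q s A B x y with hDdef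
  obtain ⟨N', hN', hN'b⟩ : ∃ N', HasDerivAt (fun x => cotNum κ p q s A B x y) N' x ∧
      |x * N'| ≤ 2 * √(N ^ 2 + D) := by
    refine ⟨B * p + (κ * p * q * A - s) * y, ?_, ?_⟩
    · unfold cotNum
      have e1 := ((((hasDerivAt_id x).const_mul p).add_const (q * y)).const_mul B).const_add A
      have e2 := ((hasDerivAt_id x).mul_const y).const_mul (κ * p * q * A - s)
      exact (e1.add e2).congr_deriv (by ring)
    -- `x * N'` is a sum of two nonnegative terms minus a third one, and each of the three is at
    -- most `√(N ^ 2 + D)`.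
    · have b1 : B * p * x ≤ √(N ^ 2 + D) := by
        refine Real.le_sqrt_of_sq_le ?_
        rw [hP]
        calc (B * p * x) ^ 2 = (p ^ 2 * x ^ 2 + κ * p ^ 2 * A * x ^ 2) * A := by
              rw [mul_pow, mul_pow, hBA]; ring
          _ ≤ _ := by
              have : p ^ 2 * x ^ 2 ≤ x ^ 2 := mul_le_of_le_one_left (by positivity) (by linarith)
              have : 0 ≤ 2 * p * B * x := by positivity
              have : 0 ≤ 2 * q * B * y := by positivity
              have : 0 ≤ κ * q ^ 2 * A * y ^ 2 := by positivity
              refine mul_le_mul ?_ ?_ hA.le (by positivity)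
              · linarith
              · linarith [sq_nonneg y]
      have b2 : κ * p * q * A * (x * y) ≤ √(N ^ 2 + D) := by
        refine Real.le_sqrt_of_sq_le ?_
        rw [hP]
        calc (κ * p * q * A * (x * y)) ^ 2
            = (κ * p ^ 2 * A * x ^ 2) * (κ * q ^ 2 * A * y ^ 2) := by ring
          _ ≤ _ := by
              gcongr
              · have : 0 ≤ 2 * p * B * x := by positivity
                nlinarith
              · have : 0 ≤ 2 * q * B * y := by positivity
                nlinarith
      have b3 : s * (x * y) ≤ √(N ^ 2 + D) := by
        refine Real.le_sqrt_of_sq_le ?_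
        rw [hP]
        calc (s * (x * y)) ^ 2 ≤ (1 * (x * y)) ^ 2 := by gcongr
          _ = x ^ 2 * y ^ 2 := by ring
          _ ≤ _ := by
              gcongr
              · have : 0 ≤ 2 * p * B * x := by positivity
                have : 0 ≤ κ * p ^ 2 * A * x ^ 2 := by positivity
                linarith
              · have : 0 ≤ 2 * q * B * y := by positivity
                have : 0 ≤ κ * q ^ 2 * A * y ^ 2 := by positivity
                linarith
      have b4 : 0 ≤ B * p * x := by positivity
      have b5 : 0 ≤ κ * p * q * A * (x * y) := by positivity
      have b6 : 0 ≤ s * (x * y) := by positivity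
      rw [abs_le]
      constructor <;> nlinarith
  obtain ⟨D', hD', hD0, hD'b⟩ : ∃ D', HasDerivAt (fun x => cotDen κ p q s A B x y) D' x ∧
      0 ≤ x * D' ∧ x * D' ≤ 2 * D := by
    -- As a function of `x`, `D` is a quadratic polynomial with nonnegative coefficients, whence `0
    -- ≤ x * D' ≤ 2 * D`.
    set c0 := A * ((1 - q ^ 2) * y ^ 2)
    set c1 := A * (2 * (s + p * q) * y) + B * (2 * y * ((p + q * s) * y))
    set c2 := A * ((1 - p ^ 2) + κ * (p ^ 2 + q ^ 2 + 2 * p * q * s) * y ^ 2) +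
      B * (2 * y * (q + p * s)) + (1 - s ^ 2) * y ^ 2
    have hc0 : 0 ≤ c0 := by positivity
    have hc1 : 0 ≤ c1 := by positivity
    have hc2 : 0 ≤ c2 := by positivity
    have hDe : ∀ x, cotDen κ p q s A B x y = c0 + c1 * x + c2 * x ^ 2 := by
      intro x; simp only [cotDen, c0, c1, c2]; ring
    refine ⟨c1 + c2 * (2 * x), ?_, by positivity, ?_⟩
    · have e1 := (((hasDerivAt_id x).const_mul c1).const_add c0).add
        (((hasDerivAt_id x).pow 2).const_mul c2)
      simp only [hDe]
      exact e1.congr_deriv (by simp)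
    · rw [hDdef, hDe]
      have := mul_nonneg hc1 hx.le
      nlinarith
  have hw := hN'.div (hD'.sqrt hD.ne') (Real.sqrt_pos.2 hD).ne'
  refine ⟨_, hw.arctan.const_sub (Real.pi / 2), ?_⟩
  -- Passing from `sin θ` to `θ` makes the estimate a bound on the logarithmic derivative of `θ`.
  have hsin := Real.sin_le (cotAngle_pos (κ := κ) (p := p) (q := q) (s := s) (A := A) (B := B)
    (x := x) (y := y)).le
  rw [cotAngle, Real.sin_pi_div_two_sub, Real.cos_arctan] at hsin
  exact (abs_mul_deriv_arctan_div_sqrt_le hD hN'b hD0 hD'b).trans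
    (mul_le_mul_of_nonneg_left hsin (by norm_num))

/-- Harnack inequality for the angle in the radius at one adjacent vertex. -/
theorem cotAngle_le_mul_left {x' l : ℝ} (hκ : 0 ≤ κ) (hp : p ∈ Set.Icc 0 1)
    (hq : q ∈ Set.Icc 0 1) (hs : s ∈ Set.Icc 0 1) (hA : 0 < A) (hB : 0 < B)
    (hBA : B ^ 2 = A * (1 + κ * A)) (hx : 0 < x) (hx' : 0 < x') (hy : 0 < y)
    (hxx' : x ≤ l * x') (hx'x : x' ≤ l * x) :
    cotAngle κ p q s A B x y ≤ l ^ 3 * cotAngle κ p q s A B x' y := by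
  have hl : 0 < l := pos_of_mul_pos_left (hx.trans_le hxx') hx'.le
  choose! d hd hdb using fun z (hz : z ∈ Set.Ioi (0 : ℝ)) =>
    exists_hasDerivAt_cotAngle hκ hp hq hs hA hB hBA hz hy
  set f := fun z => cotAngle κ p q s A B z y with hf
  have hfpos : ∀ z, 0 < f z := fun z => cotAngle_pos
  -- `|z f'| ≤ 3 f` says that `f / z ^ 3` decreases and `f * z ^ 3` increases.
  have hanti : AntitoneOn (fun z => f z / z ^ 3) (Set.Ioi 0) := by
    have hder : ∀ z ∈ Set.Ioi (0 : ℝ), HasDerivAt (fun z => f z / z ^ 3)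
        ((d z * z ^ 3 - f z * (3 * z ^ 2)) / (z ^ 3) ^ 2) z := fun z hz => by
      have := (hd z hz).div (hasDerivAt_pow 3 z) (pow_ne_zero 3 (ne_of_gt hz))
      exact this.congr_deriv (by norm_num)
    refine antitoneOn_of_deriv_nonpos (convex_Ioi 0)
      (fun z hz => (hder z hz).continuousAt.continuousWithinAt)
      (fun z hz => ((hder z (interior_subset hz)).differentiableAt.differentiableWithinAt)) ?_
    intro z hz
    have hz := interior_subset hz
    rw [(hder z hz).deriv]
    have := (abs_le.1 (hdb z hz)).2
    refine div_nonpos_of_nonpos_of_nonneg ?_ (by positivity)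
    have : (z * d z - 3 * f z) * z ^ 2 ≤ 0 :=
      mul_nonpos_of_nonpos_of_nonneg (by linarith) (by positivity)
    linarith
  have hmono : MonotoneOn (fun z => f z * z ^ 3) (Set.Ioi 0) := by
    have hder : ∀ z ∈ Set.Ioi (0 : ℝ), HasDerivAt (fun z => f z * z ^ 3)
        (d z * z ^ 3 + f z * (3 * z ^ 2)) z := fun z hz => by
      have := (hd z hz).mul (hasDerivAt_pow 3 z)
      exact this.congr_deriv (by norm_num)
    refine monotoneOn_of_deriv_nonneg (convex_Ioi 0)
      (fun z hz => (hder z hz).continuousAt.continuousWithinAt)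
      (fun z hz => ((hder z (interior_subset hz)).differentiableAt.differentiableWithinAt)) ?_
    intro z hz
    have hz := interior_subset hz
    rw [(hder z hz).deriv]
    have := (abs_le.1 (hdb z hz)).1
    have : 0 ≤ (z * d z + 3 * f z) * z ^ 2 := mul_nonneg (by linarith) (by positivity)
    linarith
  change f x ≤ l ^ 3 * f x'
  rcases le_total x x' with h | h
  · have := hmono hx hx' h
    simp only at this
    have h2 : f x' * x' ^ 3 ≤ f x' * (l * x) ^ 3 := by
      have := (hfpos x').le
      gcongr
    have h3 : f x * x ^ 3 ≤ (l ^ 3 * f x') * x ^ 3 := by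
      calc _ ≤ _ := this.trans h2
        _ = _ := by ring
    exact le_of_mul_le_mul_right h3 (by positivity)
  · have := hanti hx' hx h
    simp only at this
    rw [div_le_div_iff₀ (by positivity) (by positivity)] at this
    have h2 : f x' * x ^ 3 ≤ f x' * (l * x') ^ 3 := by
      have := (hfpos x').le
      gcongr
    have h3 : f x * x' ^ 3 ≤ (l ^ 3 * f x') * x' ^ 3 := by
      calc _ ≤ _ := this.trans h2
        _ = _ := by ring
    exact le_of_mul_le_mul_right h3 (by positivity)

/-- Harnack inequality for the angle in the radii at both adjacent vertices. -/
theorem cotAngle_le_mul {x' y' l : ℝ} (hκ : 0 ≤ κ) (hp : p ∈ Set.Icc 0 1)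
    (hq : q ∈ Set.Icc 0 1) (hs : s ∈ Set.Icc 0 1) (hA : 0 < A) (hB : 0 < B)
    (hBA : B ^ 2 = A * (1 + κ * A)) (hx : 0 < x) (hx' : 0 < x') (hy : 0 < y) (hy' : 0 < y')
    (hxx' : x ≤ l * x') (hx'x : x' ≤ l * x) (hyy' : y ≤ l * y') (hy'y : y' ≤ l * y) :
    cotAngle κ p q s A B x y ≤ l ^ 6 * cotAngle κ p q s A B x' y' := by
  have hl : 0 < l := pos_of_mul_pos_left (hx.trans_le hxx') hx'.le
  calc _ ≤ l ^ 3 * cotAngle κ p q s A B x' y :=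
        cotAngle_le_mul_left hκ hp hq hs hA hB hBA hx hx' hy hxx' hx'x
    _ ≤ l ^ 3 * (l ^ 3 * cotAngle κ p q s A B x' y') := by
        have := cotAngle_le_mul_left hκ hq hp hs hA hB hBA hy hy' hx' hyy' hy'y
        rw [cotAngle_comm, cotAngle_comm (x := x') (y := y')]
        gcongr
    _ = _ := by ring

/-- In hyperbolic geometry the angle is small if the radius at the vertex is large. -/
theorem cotAngle_le_of_kappa_eq_one (hp : p ∈ Set.Icc 0 1) (hq : q ∈ Set.Icc 0 1)
    (hs : s ∈ Set.Icc 0 1) (hA : 1 ≤ A) (hB : 0 < B) (hBA : B ^ 2 = A * (1 + A))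
    (hx : x ∈ Set.Ioc 0 1) (hy : y ∈ Set.Ioc 0 1) :
    cotAngle 1 p q s A B x y ≤ Real.pi / 2 - Real.arctan ((A - 1) / √(30 * A)) := by
  have hD := cotDen_pos zero_le_one hp hq hs (zero_lt_one.trans_le hA) hB hx.1 hy.1
  obtain ⟨hp0, hp1⟩ := hp
  obtain ⟨hq0, hq1⟩ := hq
  obtain ⟨hs0, hs1⟩ := hs
  obtain ⟨hx0, hx1⟩ := hx
  obtain ⟨hy0, hy1⟩ := hy
  have hB2 : B ≤ 2 * A := by
    refine (sq_le_sq₀ (by positivity) (by positivity)).1 ?_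
    rw [hBA]; nlinarith
  refine sub_le_sub_left (Real.arctan_mono ?_) _
  have hxy1 : x * y ≤ 1 := mul_le_one₀ hx1 hy0.le hy1
  have hxy0 : 0 < x * y := by positivity
  have hN : A - 1 ≤ cotNum 1 p q s A B x y := by
    unfold cotNum
    have : s * (x * y) ≤ 1 := mul_le_one₀ hs1 hxy0.le hxy1
    have : 0 ≤ 1 * p * q * A * (x * y) := by positivity
    have : 0 ≤ B * (p * x + q * y) := by positivity
    linarith
  -- The estimates below add up to `26 * A + 1`, so `30` is a generous constant.
  have hDle : cotDen 1 p q s A B x y ≤ 30 * A := by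
    have hpq : p * q ≤ 1 := mul_le_one₀ hp1 hq0 hq1
    have hps : p * s ≤ 1 := mul_le_one₀ hp1 hs0 hs1
    have hqs : q * s ≤ 1 := mul_le_one₀ hq1 hs0 hs1
    have hx2 : x ^ 2 ≤ 1 := pow_le_one₀ hx0.le hx1
    have hy2 : y ^ 2 ≤ 1 := pow_le_one₀ hy0.le hy1
    have hxy2 : (x * y) ^ 2 ≤ 1 := pow_le_one₀ hxy0.le hxy1
    have hp2 : p ^ 2 ≤ 1 := pow_le_one₀ hp0 hp1
    have hq2 : q ^ 2 ≤ 1 := pow_le_one₀ hq0 hq1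
    have hs2 : s ^ 2 ≤ 1 := pow_le_one₀ hs0 hs1
    have a1 : (1 - p ^ 2) * x ^ 2 ≤ 1 :=
      mul_le_one₀ (by linarith [sq_nonneg p]) (by positivity) hx2
    have a2 : (1 - q ^ 2) * y ^ 2 ≤ 1 :=
      mul_le_one₀ (by linarith [sq_nonneg q]) (by positivity) hy2
    have a3 : 2 * (s + p * q) * (x * y) ≤ 4 * 1 := by gcongr; linarith
    have a4 : 1 * (p ^ 2 + q ^ 2 + 2 * p * q * s) * (x * y) ^ 2 ≤ 4 * 1 := by
      have : p * q * s ≤ 1 := mul_le_one₀ hpq hs0 hs1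
      gcongr; linarith
    have a5 : 2 * (x * y) * ((q + p * s) * x + (p + q * s) * y) ≤ 2 * 1 * (2 * 1 + 2 * 1) := by
      gcongr <;> linarith
    have a6 : (1 - s ^ 2) * (x * y) ^ 2 ≤ 1 :=
      mul_le_one₀ (by linarith [sq_nonneg s]) (by positivity) hxy2
    calc cotDen 1 p q s A B x y
        ≤ A * (1 + 1 + 4 * 1 + 4 * 1) + 2 * A * (2 * 1 * (2 * 1 + 2 * 1)) + 1 := by
          unfold cotDen
          gcongr
      _ ≤ 30 * A := by linarith
  calc (A - 1) / √(30 * A) ≤ (A - 1) / √(cotDen 1 p q s A B x y) := by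
        have : 0 ≤ A - 1 := by linarith
        have := Real.sqrt_pos.2 hD
        gcongr
    _ ≤ _ := by gcongr

end cotAngle

theorem arccos_div_sqrt_eq_cotAngle {κ p q s A B x y : ℝ}
    (hB : B ^ 2 = A * (1 + κ * A)) (hD : 0 < cotDen κ p q s A B x y) :
    Real.arccos (cotNum κ p q s A B x y /
      √((A + 2 * p * B * x + κ * p ^ 2 * A * x ^ 2 + x ^ 2) *
        (A + 2 * q * B * y + κ * q ^ 2 * A * y ^ 2 + y ^ 2))) = cotAngle κ p q s A B x y := by
  rw [← cotNum_sq_add_cotDen hB (s := s), cotAngle, Real.arccos, Real.arctan_eq_arcsin]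
  generalize cotNum κ p q s A B x y = N
  generalize cotDen κ p q s A B x y = D at *
  have hR : 0 < √D := Real.sqrt_pos.2 hD
  have : √(N ^ 2 + D) = √(1 + (N / √D) ^ 2) * √D := by
    rw [← Real.sqrt_mul (by positivity), div_pow, Real.sq_sqrt hD.le]
    congr 1
    field_simp
    ring
  rw [this]
  have h2 : 0 < √(1 + (N / √D) ^ 2) := Real.sqrt_pos.2 (by positivity)
  congr 2
  field_simp

/-! ### The angles of a triangle of the background geometry -/

/-- The negative of the sectional curvature. -/
def kappa : Background → ℝ
  | .euclidean => 0
  | .hyperbolic => 1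

/-- The parameter `A` of `cotAngle` for the radius `r` at the vertex. -/
noncomputable def sqParam (g : Background) (r : ℝ) : ℝ :=
  match g with
  | .euclidean => r ^ 2
  | .hyperbolic => Real.sinh r ^ 2

/-- The parameter `B` of `cotAngle` for the radius `r` at the vertex. -/
noncomputable def linParam (g : Background) (r : ℝ) : ℝ :=
  match g with
  | .euclidean => r
  | .hyperbolic => Real.sinh r * Real.cosh r

/-- The parameters `x`, `y` of `cotAngle` for the radius `r` at an adjacent vertex. -/
noncomputable def sideParam (g : Background) (r : ℝ) : ℝ :=
  match g with
  | .euclidean => r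
  | .hyperbolic => Real.sinh r / Real.cosh r

theorem kappa_nonneg (g : Background) : 0 ≤ kappa g := by
  cases g <;> simp [kappa]

theorem sqParam_pos (g : Background) {r : ℝ} (hr : 0 < r) : 0 < sqParam g r := by
  have := Real.sinh_pos_iff.2 hr
  cases g <;> simp only [sqParam] <;> positivity

theorem linParam_pos (g : Background) {r : ℝ} (hr : 0 < r) : 0 < linParam g r := by
  have := Real.sinh_pos_iff.2 hr
  cases g <;> simp only [linParam] <;> positivity

theorem sideParam_pos (g : Background) {r : ℝ} (hr : 0 < r) : 0 < sideParam g r := by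
  have := Real.sinh_pos_iff.2 hr
  cases g <;> simp only [sideParam] <;> positivity

theorem linParam_sq (g : Background) (r : ℝ) :
    linParam g r ^ 2 = sqParam g r * (1 + kappa g * sqParam g r) := by
  cases g
  · simp [linParam, sqParam, kappa]
  · simp only [linParam, sqParam, kappa]
    rw [mul_pow, Real.cosh_sq']
    ring

theorem sqParam_le_sqParam (g : Background) {r r' : ℝ} (hr : 0 < r) (h : r ≤ r') :
    sqParam g r ≤ sqParam g r' := by
  have := Real.sinh_pos_iff.2 hr
  have := Real.sinh_le_sinh.2 h
  cases g <;> simp only [sqParam] <;> gcongr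

theorem linParam_le_linParam (g : Background) {r r' : ℝ} (hr : 0 < r) (h : r ≤ r') :
    linParam g r ≤ linParam g r' := by
  have := Real.sinh_pos_iff.2 hr
  have := Real.sinh_le_sinh.2 h
  have := Real.cosh_le_cosh.2 (abs_le_abs_of_nonneg hr.le h)
  cases g
  · exact h
  · simp only [linParam]; gcongr
    exact (Real.sinh_pos_iff.2 (hr.trans_le h)).le

theorem continuous_sqParam (g : Background) : Continuous (sqParam g) := by
  cases g
  · exact continuous_pow 2
  · exact Real.continuous_sinh.pow 2

theorem continuous_linParam (g : Background) : Continuous (linParam g) := by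
  cases g
  · exact continuous_id
  · exact Real.continuous_sinh.mul Real.continuous_cosh

theorem continuous_sideParam (g : Background) : Continuous (sideParam g) := by
  cases g
  · exact continuous_id
  · exact Real.continuous_sinh.div Real.continuous_cosh fun x => (Real.cosh_pos x).ne'

theorem triangleAngle_euclidean {p q s a b c : ℝ} (hp : p ∈ Set.Icc 0 1) (hq : q ∈ Set.Icc 0 1)
    (hs : s ∈ Set.Icc 0 1) (ha : 0 < a) (hb : 0 < b) (hc : 0 < c) :
    triangleAngle .euclidean (√(a ^ 2 + b ^ 2 + 2 * p * a * b)) (√(a ^ 2 + c ^ 2 + 2 * q * a * c))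
      (√(b ^ 2 + c ^ 2 + 2 * s * b * c)) = cotAngle 0 p q s (a ^ 2) a b c := by
  have hD := cotDen_pos le_rfl hp hq hs (pow_pos ha 2) ha hb hc
  rw [← arccos_div_sqrt_eq_cotAngle (by ring) hD, triangleAngle]
  obtain ⟨hp0, -⟩ := hp
  obtain ⟨hq0, -⟩ := hq
  obtain ⟨hs0, -⟩ := hs
  rw [Real.sq_sqrt (by positivity), Real.sq_sqrt (by positivity), Real.sq_sqrt (by positivity),
    mul_assoc 2 (√_), ← Real.sqrt_mul (by positivity), ← div_div]
  unfold cotNum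
  congr 2
  · ring
  · congr 1; ring

theorem triangleAngle_hyperbolic {p q s a b c : ℝ} (hp : p ∈ Set.Icc 0 1) (hq : q ∈ Set.Icc 0 1)
    (hs : s ∈ Set.Icc 0 1) (ha : 0 < a) (hb : 0 < b) (hc : 0 < c) :
    triangleAngle .hyperbolic
      (Real.arcosh (Real.cosh a * Real.cosh b + p * Real.sinh a * Real.sinh b))
      (Real.arcosh (Real.cosh a * Real.cosh c + q * Real.sinh a * Real.sinh c))
      (Real.arcosh (Real.cosh b * Real.cosh c + s * Real.sinh b * Real.sinh c)) =
    cotAngle 1 p q s (Real.sinh a ^ 2) (Real.sinh a * Real.cosh a)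
      (Real.sinh b / Real.cosh b) (Real.sinh c / Real.cosh c) := by
  have hsa := Real.sinh_pos_iff.2 ha
  have hsb := Real.sinh_pos_iff.2 hb
  have hsc := Real.sinh_pos_iff.2 hc
  have one_le : ∀ {p a b : ℝ}, 0 ≤ p → 0 < Real.sinh a → 0 < Real.sinh b →
      1 ≤ Real.cosh a * Real.cosh b + p * Real.sinh a * Real.sinh b := fun {p a b} hp ha hb => by
    have := one_le_mul_of_one_le_of_one_le (Real.one_le_cosh a) (Real.one_le_cosh b)
    have : 0 ≤ p * Real.sinh a * Real.sinh b := by positivity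
    linarith
  have hB : (Real.sinh a * Real.cosh a) ^ 2 = Real.sinh a ^ 2 * (1 + 1 * Real.sinh a ^ 2) := by
    rw [mul_pow, Real.cosh_sq']; ring
  have hD := cotDen_pos zero_le_one hp hq hs (pow_pos hsa 2)
    (mul_pos hsa (Real.cosh_pos a)) (div_pos hsb (Real.cosh_pos b)) (div_pos hsc (Real.cosh_pos c))
  rw [← arccos_div_sqrt_eq_cotAngle hB hD, triangleAngle]
  rw [Real.cosh_arcosh (one_le hp.1 hsa hsb), Real.cosh_arcosh (one_le hq.1 hsa hsc),
    Real.cosh_arcosh (one_le hs.1 hsb hsc), Real.sinh_arcosh (one_le hp.1 hsa hsb),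
    Real.sinh_arcosh (one_le hq.1 hsa hsc)]
  obtain ⟨hp0, -⟩ := hp
  obtain ⟨hq0, -⟩ := hq
  have ea := Real.cosh_sq' a
  -- This is the `sinh` of a side at `i`; the factors `cosh b` and `cosh c` split off here cancel
  -- against those of the numerator.
  have side : ∀ {p b : ℝ}, √((Real.cosh a * Real.cosh b + p * Real.sinh a * Real.sinh b) ^ 2 - 1) =
      Real.cosh b * √(Real.sinh a ^ 2 + 2 * p * (Real.sinh a * Real.cosh a) *
        (Real.sinh b / Real.cosh b) + 1 * p ^ 2 * Real.sinh a ^ 2 *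
        (Real.sinh b / Real.cosh b) ^ 2 + (Real.sinh b / Real.cosh b) ^ 2) := fun {p b} => by
    have eb := Real.cosh_sq' b
    have hcb := Real.cosh_pos b
    rw [← Real.sqrt_sq hcb.le, ← Real.sqrt_mul (by positivity), Real.sqrt_sq hcb.le]
    congr 1
    field_simp
    linear_combination (Real.cosh b ^ 2) * ea + eb
  have hcb := Real.cosh_pos b
  have hcc := Real.cosh_pos c
  have hca := Real.cosh_pos a
  rw [side, side, Real.sqrt_mul (by positivity)]
  congr 1
  rw [mul_mul_mul_comm, ← div_div]
  congr 1
  unfold cotNum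
  field_simp
  linear_combination (Real.cosh b * Real.cosh c) * ea

theorem innerAngle_eq_cotAngle {V : Type*} (g : Background) (Φ : Sym2 V → ℝ) (r : V → ℝ)
    (hr : ∀ i, 0 < r i) {i j k : V} (hp : Real.cos (Φ s(i, j)) ∈ Set.Icc 0 1)
    (hq : Real.cos (Φ s(i, k)) ∈ Set.Icc 0 1) (hs : Real.cos (Φ s(j, k)) ∈ Set.Icc 0 1) :
    innerAngle g Φ r i j k = cotAngle (kappa g) (Real.cos (Φ s(i, j))) (Real.cos (Φ s(i, k)))
      (Real.cos (Φ s(j, k))) (sqParam g (r i)) (linParam g (r i)) (sideParam g (r j))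
      (sideParam g (r k)) := by
  cases g
  · exact triangleAngle_euclidean hp hq hs (hr i) (hr j) (hr k)
  · exact triangleAngle_hyperbolic hp hq hs (hr i) (hr j) (hr k)

/-! ### The coordinate in which the flow is `du/dt = -K` -/

/-- The coordinate `u` of a radius: `log r` or `log (tanh (r / 2))`. -/
noncomputable def radCoord (g : Background) (r : ℝ) : ℝ :=
  match g with
  | .euclidean => Real.log r
  | .hyperbolic => Real.log (Real.sinh r) - Real.log (1 + Real.cosh r)

theorem flowFactor_pos (g : Background) {r : ℝ} (hr : 0 < r) : 0 < flowFactor g r := by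
  cases g
  · exact hr
  · exact Real.sinh_pos_iff.2 hr

theorem hasDerivAt_radCoord (g : Background) {r : ℝ} (hr : 0 < r) :
    HasDerivAt (radCoord g) (flowFactor g r)⁻¹ r := by
  cases g
  · exact Real.hasDerivAt_log hr.ne'
  · have hs := Real.sinh_pos_iff.2 hr
    have hc := Real.cosh_pos r
    have h1 := (Real.hasDerivAt_sinh r).log hs.ne'
    have h2 := ((Real.hasDerivAt_cosh r).const_add 1).log (by positivity)
    refine (h1.sub h2).congr_deriv ?_
    simp only [flowFactor]
    have e := Real.cosh_sq' r
    field_simp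
    linear_combination e

theorem strictMonoOn_radCoord (g : Background) : StrictMonoOn (radCoord g) (Set.Ioi 0) := by
  refine strictMonoOn_of_deriv_pos (convex_Ioi 0)
    (fun r hr => (hasDerivAt_radCoord g hr).continuousAt.continuousWithinAt) fun r hr => ?_
  rw [interior_Ioi] at hr
  rw [(hasDerivAt_radCoord g hr).deriv]
  exact inv_pos.2 (flowFactor_pos g hr)

/-- In hyperbolic geometry `tanh r = tanh (r / 2) * ((1 + cosh r) / cosh r)` with a decreasing
second factor, so for `a ≥ b` the ratio of the `tanh r` is at most that of the `exp u = tanh (r /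
2)`. -/
theorem sideParam_le_exp_mul (g : Background) {a b F : ℝ} (ha : 0 < a) (hb : 0 < b) (hF : 0 ≤ F)
    (h : radCoord g a ≤ radCoord g b + F) : sideParam g a ≤ Real.exp F * sideParam g b := by
  cases g
  · simp only [radCoord, sideParam] at *
    rw [← Real.exp_log ha, ← Real.exp_log hb, ← Real.exp_add]
    exact Real.exp_le_exp.2 (by linarith)
  · have hsa := Real.sinh_pos_iff.2 ha
    have hsb := Real.sinh_pos_iff.2 hb
    have hca := Real.cosh_pos a
    have hcb := Real.cosh_pos b
    simp only [radCoord, sideParam] at *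
    rcases le_total a b with hab | hab
    · have : Real.sinh a / Real.cosh a ≤ Real.sinh b / Real.cosh b := by
        rw [div_le_div_iff₀ hca hcb]
        have := Real.sinh_nonneg_iff.2 (sub_nonneg.2 hab)
        rw [Real.sinh_sub] at this
        linarith
      exact this.trans (le_mul_of_one_le_left (by positivity) (Real.one_le_exp hF))
    · have hcc : Real.cosh b ≤ Real.cosh a :=
        Real.cosh_le_cosh.2 (abs_le_abs_of_nonneg hb.le hab)
      rw [← Real.log_div hsa.ne' (by positivity), ← Real.log_div hsb.ne' (by positivity)] at h
      have h1 : Real.sinh a / (1 + Real.cosh a) ≤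
          Real.exp F * (Real.sinh b / (1 + Real.cosh b)) := by
        rw [← Real.exp_log (show 0 < Real.sinh a / (1 + Real.cosh a) by positivity),
          ← Real.exp_log (show 0 < Real.sinh b / (1 + Real.cosh b) by positivity), ← Real.exp_add]
        exact Real.exp_le_exp.2 (by linarith)
      have h2 : (1 + Real.cosh a) / Real.cosh a ≤ (1 + Real.cosh b) / Real.cosh b := by
        rw [div_le_div_iff₀ hca hcb]
        nlinarith
      calc Real.sinh a / Real.cosh a
          = Real.sinh a / (1 + Real.cosh a) * ((1 + Real.cosh a) / Real.cosh a) := by field_simp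
        _ ≤ Real.exp F * (Real.sinh b / (1 + Real.cosh b)) *
            ((1 + Real.cosh b) / Real.cosh b) := by gcongr
        _ = _ := by field_simp

/-! ### The curvature as a finite sum -/

section curvature

variable {V : Type*} {T : AbstractSimplicialComplex V} {Φ : Sym2 V → ℝ} {i : V}

/-- The inner angle at `i` of the face at `i` with opposite edge `e`. -/
noncomputable def angleAt (g : Background) (Φ : Sym2 V → ℝ) (r : V → ℝ) (i : V) (e : Sym2 V) : ℝ :=
  Sym2.lift ⟨fun j k => innerAngle g Φ r i j k, innerAngle_comm g Φ r i⟩ e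

theorem finite_oppositeEdges (hT : {s : Finset V | s ∈ T ∧ i ∈ s}.Finite) :
    (oppositeEdges T i).Finite := by
  classical
  refine (hT.biUnion (t := fun s => (s.sym2 : Set (Sym2 V))) fun s _ =>
    s.sym2.finite_toSet).subset ?_
  rintro _ ⟨j, k, rfl, -, -, -, f, hf, hfe⟩
  have h : ∀ v, v ∈ f ↔ v = i ∨ v = j ∨ v = k := fun v => by
    rw [← Finset.mem_coe, hfe]; simp
  refine Set.mem_biUnion (x := f) ⟨hf, (h i).2 (by simp)⟩ ?_
  rw [Finset.mem_coe, Finset.mk_mem_sym2_iff]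
  exact ⟨(h j).2 (by simp), (h k).2 (by simp)⟩

theorem curvature_eq_sum (hT : {s : Finset V | s ∈ T ∧ i ∈ s}.Finite) (g : Background)
    (Φ : Sym2 V → ℝ) (r : V → ℝ) :
    curvature g T Φ r i =
      2 * Real.pi - ∑ e ∈ (finite_oppositeEdges hT).toFinset, angleAt g Φ r i e := by
  rw [curvature, finsum_mem_eq_finite_toFinset_sum _ (finite_oppositeEdges hT)]
  rfl

theorem adj_of_mem_face {f : Finset V} (hf : f ∈ T) {j k : V} (hjk : j ≠ k) (hj : j ∈ f)
    (hk : k ∈ f) : s(j, k) ∈ (oneSkeleton T).edgeSet := by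
  classical
  refine ⟨hjk, {j, k}, ?_, by simp⟩
  exact (T.isRelLowerSet_faces hf).2 (by simp [Finset.insert_subset_iff, hj, hk]) (by simp)

/-- The angle at `i` in terms of the parameters of `cotAngle`. -/
theorem exists_angleAt_eq (hΦ : ∀ e ∈ (oneSkeleton T).edgeSet, Φ e ∈ Set.Icc 0 (Real.pi / 2))
    {e : Sym2 V} (he : e ∈ oppositeEdges T i) :
    ∃ j k : V, ∃ p ∈ Set.Icc (0 : ℝ) 1, ∃ q ∈ Set.Icc (0 : ℝ) 1, ∃ s ∈ Set.Icc (0 : ℝ) 1,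
      ∀ (g : Background) (r : V → ℝ), (∀ i, 0 < r i) → angleAt g Φ r i e =
        cotAngle (kappa g) p q s (sqParam g (r i)) (linParam g (r i)) (sideParam g (r j))
          (sideParam g (r k)) := by
  obtain ⟨j, k, rfl, hij, hik, hjk, f, hf, hfe⟩ := he
  have h : ∀ v, v ∈ f ↔ v = i ∨ v = j ∨ v = k := fun v => by
    rw [← Finset.mem_coe, hfe]; simp
  have hi := (h i).2 (by simp)
  have hj := (h j).2 (by simp)
  have hk := (h k).2 (by simp)
  have hcos : ∀ e ∈ (oneSkeleton T).edgeSet, Real.cos (Φ e) ∈ Set.Icc (0 : ℝ) 1 := fun e he =>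
    ⟨Real.cos_nonneg_of_mem_Icc ⟨by linarith [Real.pi_pos, (hΦ e he).1], (hΦ e he).2⟩,
      Real.cos_le_one _⟩
  exact ⟨j, k, _, hcos _ (adj_of_mem_face hf hij hi hj), _, hcos _ (adj_of_mem_face hf hik hi hk),
    _, hcos _ (adj_of_mem_face hf hjk hj hk), fun g r hr => innerAngle_eq_cotAngle g Φ r hr
      (hcos _ (adj_of_mem_face hf hij hi hj)) (hcos _ (adj_of_mem_face hf hik hi hk))
      (hcos _ (adj_of_mem_face hf hjk hj hk))⟩

theorem angleAt_nonneg (g : Background) (Φ : Sym2 V → ℝ) (r : V → ℝ) (i : V) (e : Sym2 V) :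
    0 ≤ angleAt g Φ r i e := by
  induction e with | _ j k => cases g <;> exact Real.arccos_nonneg _

theorem angleAt_le_pi (g : Background) (Φ : Sym2 V → ℝ) (r : V → ℝ) (i : V) (e : Sym2 V) :
    angleAt g Φ r i e ≤ Real.pi := by
  induction e with | _ j k => cases g <;> exact Real.arccos_le_pi _

/-- Lowering the radius at `i` from `r i` to `r' i` only enlarges the angle; the Harnack inequality
then costs `exp (3 * F)` for each of the two other vertices. -/
theorem angleAt_le_exp_mul (hΦ : ∀ e ∈ (oneSkeleton T).edgeSet, Φ e ∈ Set.Icc 0 (Real.pi / 2))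
    {e : Sym2 V} (he : e ∈ oppositeEdges T i) {g : Background} {r r' : V → ℝ}
    (hr : ∀ i, 0 < r i) (hr' : ∀ i, 0 < r' i) {F : ℝ}
    (hF : ∀ j, |radCoord g (r j) - radCoord g (r' j)| ≤ F) (hi : r' i ≤ r i) :
    angleAt g Φ r i e ≤ Real.exp (6 * F) * angleAt g Φ r' i e := by
  obtain ⟨j, k, p, hp, q, hq, s, hs, h⟩ := exists_angleAt_eq hΦ he
  rw [h g r hr, h g r' hr']
  have hκ := kappa_nonneg g
  have hF0 : 0 ≤ F := (abs_nonneg _).trans (hF i)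
  have hle : ∀ v, sideParam g (r v) ≤ Real.exp F * sideParam g (r' v) := fun v =>
    sideParam_le_exp_mul g (hr v) (hr' v) hF0 (by linarith [(abs_le.1 (hF v)).2])
  have hle' : ∀ v, sideParam g (r' v) ≤ Real.exp F * sideParam g (r v) := fun v =>
    sideParam_le_exp_mul g (hr' v) (hr v) hF0 (by linarith [(abs_le.1 (hF v)).1])
  refine (cotAngle_le_of_le hκ hp hq hs (sideParam_pos g (hr j)) (sideParam_pos g (hr k))
    (sqParam_pos g (hr' i)) (linParam_pos g (hr' i)) (linParam_sq g _) (linParam_sq g _)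
    (sqParam_le_sqParam g (hr' i) hi) (linParam_le_linParam g (hr' i) hi)).trans ?_
  rw [show (6 : ℝ) * F = (6 : ℕ) * F by norm_num, Real.exp_nat_mul]
  exact cotAngle_le_mul hκ hp hq hs (sqParam_pos g (hr' i)) (linParam_pos g (hr' i))
    (linParam_sq g _) (sideParam_pos g (hr j)) (sideParam_pos g (hr' j)) (sideParam_pos g (hr k))
    (sideParam_pos g (hr' k)) (hle j) (hle' j) (hle k) (hle' k)

/-- The curvature depends continuously on the radii. -/
theorem continuous_curvature_comp {X : Type*} [TopologicalSpace X]
    (hT : {s : Finset V | s ∈ T ∧ i ∈ s}.Finite)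
    (hΦ : ∀ e ∈ (oneSkeleton T).edgeSet, Φ e ∈ Set.Icc 0 (Real.pi / 2)) (g : Background)
    {r : X → V → ℝ} (hr : ∀ x i, 0 < r x i) (hc : Continuous r) :
    Continuous fun x => curvature g T Φ (r x) i := by
  simp only [curvature_eq_sum hT]
  refine continuous_const.sub (continuous_finsetSum _ fun e he => ?_)
  obtain ⟨j, k, p, hp, q, hq, s, hs, h⟩ :=
    exists_angleAt_eq hΦ ((finite_oppositeEdges hT).mem_toFinset.1 he)
  simp only [fun x => h g (r x) (hr x)]
  have hci : ∀ v, Continuous fun x => r x v := fun v => (continuous_apply v).comp hc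
  have h1 := (continuous_sqParam g).comp (hci i)
  have h2 := (continuous_linParam g).comp (hci i)
  have h3 := (continuous_sideParam g).comp (hci j)
  have h4 := (continuous_sideParam g).comp (hci k)
  have hD := fun x => Real.sqrt_pos.2 (cotDen_pos (kappa_nonneg g) hp hq hs
    (sqParam_pos g (hr x i)) (linParam_pos g (hr x i)) (sideParam_pos g (hr x j))
    (sideParam_pos g (hr x k)))
  simp only [Function.comp_def] at h1 h2 h3 h4
  refine continuous_const.sub (Real.continuous_arctan.comp (Continuous.div ?_ ?_
    fun x => (hD x).ne'))
  · unfold cotNum; fun_prop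
  · unfold cotDen; fun_prop

/-- A bound of the curvature that depends only on the number of faces at the vertex. -/
theorem exists_abs_curvature_le (hT : {s : Finset V | s ∈ T ∧ i ∈ s}.Finite) (g : Background)
    (Φ : Sym2 V → ℝ) : ∃ C, ∀ r : V → ℝ, |curvature g T Φ r i| ≤ C := by
  refine ⟨2 * Real.pi + (finite_oppositeEdges hT).toFinset.card • Real.pi, fun r => ?_⟩
  rw [curvature_eq_sum hT]
  have h1 := Finset.sum_le_card_nsmul (finite_oppositeEdges hT).toFinset (angleAt g Φ r i) _
    fun e _ => angleAt_le_pi g Φ r i e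
  have h2 := Finset.sum_nonneg fun e (_ : e ∈ (finite_oppositeEdges hT).toFinset) =>
    angleAt_nonneg g Φ r i e
  rw [abs_le]
  constructor <;> linarith [Real.pi_pos]

/-- In hyperbolic geometry the curvature is positive at a vertex with a large radius. -/
theorem eventually_curvature_pos (hT : {s : Finset V | s ∈ T ∧ i ∈ s}.Finite)
    (hΦ : ∀ e ∈ (oneSkeleton T).edgeSet, Φ e ∈ Set.Icc 0 (Real.pi / 2)) :
    ∀ᶠ R in Filter.atTop, ∀ r : V → ℝ, (∀ i, 0 < r i) → r i = R →
      0 < curvature .hyperbolic T Φ r i := by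
  set E := (finite_oppositeEdges hT).toFinset with hE
  have hsinh : Filter.Tendsto Real.sinh Filter.atTop Filter.atTop :=
    Filter.tendsto_atTop_mono' _ (Filter.eventually_ge_atTop 0 |>.mono fun x hx =>
      Real.self_le_sinh_iff.2 hx) Filter.tendsto_id
  have hlim : Filter.Tendsto (fun R => (E.card : ℝ) * (Real.pi / 2 -
      Real.arctan ((Real.sinh R ^ 2 - 1) / √(30 * Real.sinh R ^ 2)))) Filter.atTop (nhds 0) := by
    -- The bound on a single angle tends to zero uniformly in the adjacent radii, and the number of
    -- angles at `i` is fixed.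
    have h1 : Filter.Tendsto (fun R => (Real.sinh R - 1) / √30) Filter.atTop Filter.atTop :=
      (Filter.tendsto_atTop_add_const_right _ _ hsinh).atTop_div_const (by positivity)
    have h2 : Filter.Tendsto (fun R => (Real.sinh R ^ 2 - 1) / √(30 * Real.sinh R ^ 2))
        Filter.atTop Filter.atTop := by
      refine Filter.tendsto_atTop_mono' _ ?_ h1
      filter_upwards [hsinh.eventually_ge_atTop 1] with R hR
      have h0 : 0 < Real.sinh R := by linarith
      rw [Real.sqrt_mul (by norm_num), Real.sqrt_sq h0.le, div_le_div_iff₀ (by positivity)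
        (by positivity)]
      have : 0 < √(30 : ℝ) := by positivity
      nlinarith
    have h3 := (tendsto_nhds_of_tendsto_nhdsWithin Real.tendsto_arctan_atTop).comp h2
    simpa using (h3.const_sub (Real.pi / 2)).const_mul (E.card : ℝ)
  filter_upwards [hlim.eventually (gt_mem_nhds (show (0 : ℝ) < 2 * Real.pi by positivity)),
    hsinh.eventually_ge_atTop 1] with R hR hR1 r hr hri
  rw [curvature_eq_sum hT, sub_pos]
  refine lt_of_le_of_lt ?_ hR
  rw [← nsmul_eq_mul]
  refine Finset.sum_le_card_nsmul _ _ _ fun e he => ?_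
  obtain ⟨j, k, p, hp, q, hq, s, hs, h⟩ :=
    exists_angleAt_eq hΦ ((finite_oppositeEdges hT).mem_toFinset.1 he)
  rw [h _ r hr, hri]
  have hside : ∀ v, sideParam .hyperbolic (r v) ∈ Set.Ioc (0 : ℝ) 1 := fun v =>
    ⟨sideParam_pos _ (hr v), (div_le_one (Real.cosh_pos _)).2 (Real.sinh_lt_cosh _).le⟩
  refine cotAngle_le_of_kappa_eq_one hp hq hs (one_le_pow₀ hR1)
    (linParam_pos .hyperbolic (hri ▸ hr i)) ?_ (hside j) (hside k)
  simpa [kappa] using linParam_sq .hyperbolic R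

end curvature

/-! ### Uniqueness -/

/-- A uniformly bounded family of functions that start at zero vanishes if its members move away
from zero at a rate of at most a constant times the supremum of the family. -/
theorem eq_zero_of_deriv_le_mul_sup {ι : Type*} {f f' : ℝ → ι → ℝ} {b L F₀ : ℝ} (hL : 0 < L)
    (hF₀ : 0 < F₀)
    (hf : ∀ t ∈ Set.Icc 0 b, ∀ i, HasDerivWithinAt (fun s => f s i) (f' t i) (Set.Ici 0) t)
    (h0 : ∀ i, f 0 i = 0) (hbound : ∀ t ∈ Set.Icc 0 b, ∀ i, |f t i| ≤ F₀)
    (hle : ∀ t ∈ Set.Icc 0 b, ∀ F ≤ F₀, (∀ j, |f t j| ≤ F) → ∀ i, 0 ≤ f t i → f' t i ≤ L * F)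
    (hge : ∀ t ∈ Set.Icc 0 b, ∀ F ≤ F₀, (∀ j, |f t j| ≤ F) → ∀ i, f t i ≤ 0 → -(L * F) ≤ f' t i) :
    ∀ t ∈ Set.Icc 0 b, ∀ i, f t i = 0 := by
  -- The supremum over `ι` need be neither attained nor differentiable, so each coordinate is
  -- compared with an explicit barrier and the bound is iterated. Any ratio strictly between `1 / 2`
  -- and `1` would serve: the barrier grows at rate `2 * L`, and `3 / 4 * (2 * L) > L`.
  have key : ∀ n : ℕ, ∀ t ∈ Set.Icc 0 b, ∀ i,
      |f t i| ≤ (3 / 4) ^ n * F₀ * Real.exp (2 * L * t) := by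
    intro n
    induction n with
    | zero =>
      intro t ht i
      have h1 : 1 ≤ Real.exp (2 * L * t) := Real.one_le_exp (by have := ht.1; positivity)
      calc _ ≤ F₀ := hbound t ht i
        _ ≤ _ := by rw [pow_zero, one_mul]; exact le_mul_of_one_le_right hF₀.le h1
    | succ n ih =>
      set A := (3 / 4) ^ n * F₀ with hA
      have hApos : 0 < A := by positivity
      have hAs : (3 / 4) ^ (n + 1) * F₀ = 3 / 4 * A := by rw [hA]; ring
      rw [hAs]
      have hB : ∀ t, HasDerivAt (fun t => 3 / 4 * A * Real.exp (2 * L * t))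
          (3 / 4 * A * (Real.exp (2 * L * t) * (2 * L))) t := fun t => by
        have := ((hasDerivAt_id t).const_mul (2 * L)).exp.const_mul (3 / 4 * A)
        simpa using this
      -- The minimum with `F₀` is needed because the rate estimates are only available for `F ≤ F₀`.
      have hF : ∀ t ∈ Set.Icc 0 b, ∀ j, |f t j| ≤ min F₀ (A * Real.exp (2 * L * t)) :=
        fun t ht j => le_min (hbound t ht j) (ih t ht j)
      have hlt : ∀ t, L * min F₀ (A * Real.exp (2 * L * t)) <
          3 / 4 * A * (Real.exp (2 * L * t) * (2 * L)) := fun t => by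
        calc _ ≤ L * (A * Real.exp (2 * L * t)) := by gcongr; exact min_le_right _ _
          _ < _ := by
            have : 0 < L * (A * Real.exp (2 * L * t)) := by positivity
            linarith
      have hcont : ∀ i, ContinuousOn (fun t => f t i) (Set.Icc 0 b) := fun i t ht =>
        (hf t ht i).continuousWithinAt.mono Set.Icc_subset_Ici_self
      have hder : ∀ i, ∀ t ∈ Set.Ico 0 b,
          HasDerivWithinAt (fun s => f s i) (f' t i) (Set.Ici t) t := fun i t ht =>
        (hf t (Set.Ico_subset_Icc_self ht) i).mono (Set.Ici_subset_Ici.2 ht.1)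
      intro t ht i
      rw [abs_le]
      constructor
      -- The derivatives are compared only where `f` meets the barrier; there its sign is known, so
      -- the one-sided rate estimates apply.
      · have := image_le_of_deriv_right_lt_deriv_boundary (hcont i).neg
          (fun t ht => (hder i t ht).neg) (by simp [h0]; positivity) hB
          (fun t ht he => by
            have ht' := Set.Ico_subset_Icc_self ht
            have hpos : 0 < 3 / 4 * A * Real.exp (2 * L * t) := by positivity
            simp only [Pi.neg_apply] at he
            have := hge t ht' _ (min_le_left _ _) (hF t ht') i (by linarith)
            linarith [hlt t]) ht
        simp only [Pi.neg_apply] at this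
        linarith
      · exact image_le_of_deriv_right_lt_deriv_boundary (hcont i) (hder i)
          (by simp [h0]; positivity) hB
          (fun t ht he => by
            have ht' := Set.Ico_subset_Icc_self ht
            have hpos : 0 < 3 / 4 * A * Real.exp (2 * L * t) := by positivity
            exact (hle t ht' _ (min_le_left _ _) (hF t ht') i (by linarith)).trans_lt (hlt t)) ht
  intro t ht i
  have hlim : Filter.Tendsto (fun n : ℕ => (3 / 4 : ℝ) ^ n * F₀ * Real.exp (2 * L * t))
      Filter.atTop (nhds 0) := by
    have := ((tendsto_pow_atTop_nhds_zero_of_lt_one (r := (3 / 4 : ℝ)) (by norm_num)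
      (by norm_num)).mul_const F₀).mul_const (Real.exp (2 * L * t))
    simpa using this
  exact abs_nonpos_iff.1 (ge_of_tendsto' hlim fun n => key n t ht i)

/-! ### Comparison of two solutions with bounded curvature -/

section

variable {V : Type*} {T : AbstractSimplicialComplex V} {Φ : Sym2 V → ℝ} {g : Background}

theorem IsSolution.hasDerivWithinAt_radCoord {r : ℝ → V → ℝ} (h : IsSolution g T Φ r) {t : ℝ}
    (ht : 0 ≤ t) (i : V) :
    HasDerivWithinAt (fun s => radCoord g (r s i)) (-curvature g T Φ (r t) i) (Set.Ici 0) t := by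
  have := (hasDerivAt_radCoord g (h.pos t ht i)).comp_hasDerivWithinAt t (h.flow t ht i)
  refine this.congr_deriv ?_
  have := (flowFactor_pos g (h.pos t ht i)).ne'
  field_simp

/-- The constant does not involve the number of faces at `i`: the angle sum `S'` of `r'` is `2π - K'
≤ 2π + M`, and the angle sum of `r` exceeds it at most by the factor `exp (6 * F)`. -/
theorem curvature_sub_le {i : V} (hT : {s : Finset V | s ∈ T ∧ i ∈ s}.Finite)
    (hΦ : ∀ e ∈ (oneSkeleton T).edgeSet, Φ e ∈ Set.Icc 0 (Real.pi / 2)) {r r' : V → ℝ}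
    (hr : ∀ i, 0 < r i) (hr' : ∀ i, 0 < r' i) {F F₀ M : ℝ}
    (hF : ∀ j, |radCoord g (r j) - radCoord g (r' j)| ≤ F) (hFF₀ : F ≤ F₀)
    (hM : |curvature g T Φ r' i| ≤ M) (hi : 0 ≤ radCoord g (r i) - radCoord g (r' i)) :
    curvature g T Φ r' i - curvature g T Φ r i ≤
      6 * Real.exp (6 * F₀) * (2 * Real.pi + M) * F := by
  have hF0 : 0 ≤ F := (abs_nonneg _).trans (hF i)
  have hri : r' i ≤ r i :=
    ((strictMonoOn_radCoord g).le_iff_le (hr' i) (hr i)).1 (sub_nonneg.1 hi)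
  have hM' := (abs_le.1 hM).1
  rw [curvature_eq_sum hT] at *
  rw [curvature_eq_sum hT]
  have hsum := Finset.sum_le_sum fun e he => angleAt_le_exp_mul hΦ
    ((finite_oppositeEdges hT).mem_toFinset.1 he) hr hr' hF hri
  rw [← Finset.mul_sum] at hsum
  have hnn := Finset.sum_nonneg fun e (_ : e ∈ (finite_oppositeEdges hT).toFinset) =>
    angleAt_nonneg g Φ r' i e
  generalize ∑ e ∈ (finite_oppositeEdges hT).toFinset, angleAt g Φ r' i e = S' at *
  generalize ∑ e ∈ (finite_oppositeEdges hT).toFinset, angleAt g Φ r i e = S at *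
  -- From `1 - 6 * F ≤ exp (-(6 * F))`, multiplied by `exp (6 * F)`.
  have h1 : Real.exp (6 * F) - 1 ≤ 6 * F * Real.exp (6 * F₀) := by
    have h2 : 6 * F * Real.exp (6 * F) ≤ 6 * F * Real.exp (6 * F₀) := by gcongr
    have h3 := Real.add_one_le_exp (-(6 * F))
    have h4 : Real.exp (6 * F) * Real.exp (-(6 * F)) = 1 := by rw [← Real.exp_add]; simp
    nlinarith [Real.exp_pos (6 * F)]
  calc 2 * Real.pi - S' - (2 * Real.pi - S) ≤ (Real.exp (6 * F) - 1) * S' := by linarith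
    _ ≤ 6 * F * Real.exp (6 * F₀) * (2 * Real.pi + M) := by gcongr; linarith
    _ = _ := by ring

theorem IsSolution.eq_of_boundedCurvature
    (hT : ∀ i, {s : Finset V | s ∈ T ∧ i ∈ s}.Finite)
    (hΦ : ∀ e ∈ (oneSkeleton T).edgeSet, Φ e ∈ Set.Icc 0 (Real.pi / 2)) {r r' : ℝ → V → ℝ}
    (hr : IsSolution g T Φ r) (hr' : IsSolution g T Φ r') (h0 : r 0 = r' 0)
    (hb : BoundedCurvature g T Φ r) (hb' : BoundedCurvature g T Φ r') {t : ℝ} (ht : 0 ≤ t) :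
    r t = r' t := by
  obtain ⟨M₁, hM₁⟩ := hb
  obtain ⟨M₂, hM₂⟩ := hb'
  set M := max (max M₁ M₂) 0
  replace hM₁ : ∀ t, 0 ≤ t → ∀ i, |curvature g T Φ (r t) i| ≤ M := fun t ht i =>
    (hM₁ t ht i).trans ((le_max_left _ _).trans (le_max_left _ _))
  replace hM₂ : ∀ t, 0 ≤ t → ∀ i, |curvature g T Φ (r' t) i| ≤ M := fun t ht i =>
    (hM₂ t ht i).trans ((le_max_right _ _).trans (le_max_left _ _))
  have hM : 0 ≤ M := le_max_right _ _
  clear_value M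
  set f : ℝ → V → ℝ := fun t i => radCoord g (r t i) - radCoord g (r' t i) with hfdef
  have hder : ∀ t, 0 ≤ t → ∀ i, HasDerivWithinAt (fun s => f s i)
      (-curvature g T Φ (r t) i - -curvature g T Φ (r' t) i) (Set.Ici 0) t := fun t ht i =>
    (hr.hasDerivWithinAt_radCoord ht i).sub (hr'.hasDerivWithinAt_radCoord ht i)
  have hf0 : ∀ i, f 0 i = 0 := fun i => by simp [hfdef, h0]
  -- Bounded curvature bounds `f` uniformly over `V` on a finite time interval; the summand `1`
  -- keeps the bound positive.
  have hbound : ∀ s ∈ Set.Icc 0 t, ∀ i, |f s i| ≤ 2 * M * t + 1 := fun s hs i => by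
    have := (convex_Ici (0 : ℝ)).norm_image_sub_le_of_norm_hasDerivWithin_le (C := 2 * M)
      (fun t ht => hder t ht i) (fun t ht => by
        have h1 := abs_le.1 (hM₁ t ht i)
        have h2 := abs_le.1 (hM₂ t ht i)
        rw [Real.norm_eq_abs, abs_le]
        constructor <;> linarith) (Set.self_mem_Ici) hs.1
    rw [hf0, sub_zero, sub_zero, Real.norm_eq_abs, Real.norm_eq_abs, abs_of_nonneg hs.1] at this
    have : 2 * M * s ≤ 2 * M * t := by have := hs.2; gcongr
    linarith
  have hzero := eq_zero_of_deriv_le_mul_sup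
    (L := 6 * Real.exp (6 * (2 * M * t + 1)) * (2 * Real.pi + M)) (by positivity)
    (by positivity) (fun t ht i => hder t ht.1 i) hf0 hbound
    (fun s hs F hF hj i hi => by
      have := curvature_sub_le (hT i) hΦ (hr.pos s hs.1) (hr'.pos s hs.1) hj hF
        (hM₂ s hs.1 i) hi
      linarith)
    -- Where `f` is nonpositive the two solutions exchange roles, so the curvature bound of the
    -- other one enters.
    (fun s hs F hF hj i hi => by
      have := curvature_sub_le (hT i) hΦ (hr'.pos s hs.1) (hr.pos s hs.1)
        (fun j => by rw [abs_sub_comm]; exact hj j) hF (hM₁ s hs.1 i)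
        (by simp only [hfdef] at hi; linarith)
      linarith)
  ext i
  exact (strictMonoOn_radCoord g).injOn (hr.pos t ht i) (hr'.pos t ht i)
    (sub_eq_zero.1 (hzero t ⟨ht, le_rfl⟩ i))

end

/-! ### Existence -/

/-- The points of the Euler polygon of `dx/dt = G x` with step `h`. -/
def eulerPoint {ι : Type*} (G : (ι → ℝ) → ι → ℝ) (x₀ : ι → ℝ) (h : ℝ) : ℕ → ι → ℝ
  | 0 => x₀
  | n + 1 => fun i => eulerPoint G x₀ h n i + h * G (eulerPoint G x₀ h n) i

/-- A discrete mean value inequality: as long as the field stays within `η` of `c`, so does the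
average slope of the polygon. -/
theorem abs_eulerPoint_sub_le_of_le {ι : Type*} {G : (ι → ℝ) → ι → ℝ} {x₀ : ι → ℝ} {h : ℝ}
    (hh : 0 ≤ h) {i : ι} {c η : ℝ} {m n : ℕ} (hmn : m ≤ n)
    (hη : ∀ k, m ≤ k → k < n → |G (eulerPoint G x₀ h k) i - c| ≤ η) :
    |eulerPoint G x₀ h n i - eulerPoint G x₀ h m i - h * (n - m) * c| ≤ h * (n - m) * η := by
  induction n, hmn using Nat.le_induction with
  | base => simp
  | succ n hmn ih =>
    have h1 := ih fun k hk hkn => hη k hk (hkn.trans n.lt_succ_self)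
    have h2 : |h * (G (eulerPoint G x₀ h n) i - c)| ≤ h * η := by
      rw [abs_mul, abs_of_nonneg hh]
      exact mul_le_mul_of_nonneg_left (hη n hmn n.lt_succ_self) hh
    have e : eulerPoint G x₀ h (n + 1) i - eulerPoint G x₀ h m i - h * ((n + 1 : ℕ) - m) * c =
        (eulerPoint G x₀ h n i - eulerPoint G x₀ h m i - h * (n - m) * c) +
          h * (G (eulerPoint G x₀ h n) i - c) := by
      simp only [eulerPoint]; push_cast; ring
    rw [e]
    refine (abs_add_le _ _).trans ((add_le_add h1 h2).trans_eq ?_)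
    push_cast; ring

theorem abs_eulerPoint_sub_le {ι : Type*} {G : (ι → ℝ) → ι → ℝ} {x₀ : ι → ℝ} {h : ℝ}
    (hh : 0 ≤ h) {i : ι} {c η : ℝ} {m n : ℕ}
    (hη : ∀ k ∈ Set.uIcc m n, |G (eulerPoint G x₀ h k) i - c| ≤ η) :
    |eulerPoint G x₀ h n i - eulerPoint G x₀ h m i - h * (n - m) * c| ≤ |h * (n - m)| * η := by
  rw [abs_mul, abs_of_nonneg hh]
  rcases le_total m n with hmn | hmn
  · rw [abs_of_nonneg (sub_nonneg.2 (Nat.cast_le.2 hmn))]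
    exact abs_eulerPoint_sub_le_of_le hh hmn fun k h1 h2 =>
      hη k (Set.mem_uIcc.2 (Or.inl ⟨h1, h2.le⟩))
  · rw [abs_sub_comm (n : ℝ), abs_of_nonneg (sub_nonneg.2 (Nat.cast_le.2 hmn)), ← abs_neg]
    convert abs_eulerPoint_sub_le_of_le hh hmn fun k h1 h2 =>
      hη k (Set.mem_uIcc.2 (Or.inr ⟨h1, h2.le⟩)) using 2
    ring

/-- **Peano existence theorem** for an arbitrary set of coordinates: a vector field that
is continuous in the product topology and has bounded coordinates has an integral curve for all
positive times. -/
theorem exists_hasDerivWithinAt_of_continuous {ι : Type*} {G : (ι → ℝ) → ι → ℝ}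
    (hG : Continuous G) {C : ι → ℝ} (hC : ∀ x i, |G x i| ≤ C i) (x₀ : ι → ℝ) :
    ∃ x : ℝ → ι → ℝ, x 0 = x₀ ∧ ∀ t, 0 ≤ t → ∀ i,
      HasDerivWithinAt (fun s => x s i) (G (x t) i) (Set.Ici 0) t := by
  have hC0 : ∀ i, 0 ≤ C i := fun i => (abs_nonneg _).trans (hC x₀ i)
  set h : ℕ → ℝ := fun N => ((N : ℝ) + 1)⁻¹ with hh
  have hpos : ∀ N, 0 < h N := fun N => by positivity
  set a : ℝ → ℕ → ℕ := fun t N => ⌊t * ((N : ℝ) + 1)⌋₊ with ha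
  set U : ℕ → ℕ → ι → ℝ := fun N => eulerPoint G x₀ (h N) with hU
  have hlip : ∀ N m n i, |U N n i - U N m i| ≤ |h N * (n - m)| * C i := fun N m n i => by
    have := abs_eulerPoint_sub_le (hpos N).le (c := 0) (m := m) (n := n)
      fun k _ => by simpa using hC (eulerPoint G x₀ (h N) k) i
    simpa using this
  -- Limits along a nonprincipal ultrafilter replace the extraction of subsequences: at every time
  -- and in every coordinate the polygons stay in a compact interval, hence converge.
  have hle : (Filter.hyperfilter ℕ : Filter ℕ) ≤ Filter.atTop :=
    Nat.hyperfilter_le_atTop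
  have hstep : ∀ t, 0 ≤ t → Filter.Tendsto (fun N => h N * a t N) (Filter.hyperfilter ℕ)
      (nhds t) := fun t ht => by
    have h1 : Filter.Tendsto (fun N : ℕ => (N : ℝ) + 1) Filter.atTop Filter.atTop :=
      Filter.tendsto_atTop_add_const_right _ _ tendsto_natCast_atTop_atTop
    have h2 := ((tendsto_nat_floor_mul_div_atTop ht).comp h1).mono_left hle
    refine h2.congr fun N => ?_
    simp only [Function.comp_apply, hh, ha]
    rw [div_eq_inv_mul]
  have hstep' : ∀ s t, 0 ≤ s → 0 ≤ t → Filter.Tendsto (fun N => h N * ((a s N : ℝ) - a t N))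
      (Filter.hyperfilter ℕ) (nhds (s - t)) := fun s t hs ht =>
    ((hstep s hs).sub (hstep t ht)).congr fun N => by ring
  have hex : ∀ t, 0 ≤ t → ∀ i, ∃ y, Filter.Tendsto (fun N => U N (a t N) i)
      (Filter.hyperfilter ℕ) (nhds y) := fun t ht i => by
    have hmem : ∀ N, U N (a t N) i ∈ Set.Icc (x₀ i - t * C i) (x₀ i + t * C i) := fun N => by
      have h1 := hlip N 0 (a t N) i
      have h2 : |h N * ((a t N : ℝ) - (0 : ℕ))| ≤ t := by
        rw [Nat.cast_zero, sub_zero, abs_of_nonneg (mul_nonneg (hpos N).le (Nat.cast_nonneg _)),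
          inv_mul_le_iff₀ (by positivity), mul_comm]
        exact Nat.floor_le (by positivity)
      have h3 := abs_le.1 (h1.trans (mul_le_mul_of_nonneg_right h2 (hC0 i)))
      have h4 : U N 0 i = x₀ i := rfl
      rw [h4] at h3
      constructor <;> linarith
    obtain ⟨y, -, hy⟩ := isCompact_Icc.ultrafilter_le_nhds'
      ((Filter.hyperfilter ℕ).map fun N => U N (a t N) i)
      (Ultrafilter.mem_map.2 (Filter.univ_mem' hmem))
    exact ⟨y, hy⟩
  choose! x hx using hex
  refine ⟨x, ?_, fun t ht i => ?_⟩
  · ext i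
    refine tendsto_nhds_unique (hx 0 le_rfl i) (tendsto_const_nhds.congr fun N => ?_)
    simp [ha, hU, eulerPoint]
  rw [hasDerivWithinAt_iff_isLittleO, Asymptotics.isLittleO_iff]
  intro ε hε
  have hW : {y | |G y i - G (x t) i| ≤ ε} ∈ nhds (x t) := by
    have h1 : Filter.Tendsto (fun y => |G y i - G (x t) i|) (nhds (x t)) (nhds 0) := by
      have : Continuous fun y => |G y i - G (x t) i| :=
        (((continuous_apply i).comp hG).sub continuous_const).abs
      simpa using this.tendsto (x t)
    exact h1.eventually (ge_mem_nhds hε)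
  -- A neighbourhood in the product topology restricts only finitely many coordinates `J`, so one
  -- range of `s` near `t` and one set of `N` keep all intermediate Euler points in it.
  rw [nhds_pi, Filter.mem_pi] at hW
  obtain ⟨J, hJ, W, hW, hJW⟩ := hW
  choose δ hδ hδW using fun j => Metric.mem_nhds_iff.1 (hW j)
  have hs : ∀ᶠ s in nhdsWithin t (Set.Ici 0), ∀ j ∈ J, |s - t| * C j < δ j := by
    refine (hJ.eventually_all).2 fun j _ => ?_
    have h1 : Continuous fun s : ℝ => |s - t| * C j := by fun_prop
    have h2 := h1.tendsto t
    rw [sub_self, abs_zero, zero_mul] at h2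
    exact (h2.eventually (gt_mem_nhds (hδ j))).filter_mono nhdsWithin_le_nhds
  filter_upwards [hs, self_mem_nhdsWithin] with s hs hs0
  have hN : ∀ᶠ N in (Filter.hyperfilter ℕ : Filter ℕ), ∀ j ∈ J,
      |U N (a t N) j - x t j| + |h N * ((a s N : ℝ) - a t N)| * C j < δ j := by
    refine (hJ.eventually_all).2 fun j hj => ?_
    have h1 := ((hx t ht j).sub_const (x t j)).abs.add ((hstep' s t hs0 ht).abs.mul_const (C j))
    rw [sub_self, abs_zero, zero_add] at h1
    exact h1.eventually (gt_mem_nhds (hs j hj))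
  have hlim := (((hx s hs0 i).sub (hx t ht i)).sub
    ((hstep' s t hs0 ht).mul_const (G (x t) i))).abs
  have hlim' := (hstep' s t hs0 ht).abs.mul_const ε
  simp only [smul_eq_mul, Real.norm_eq_abs]
  rw [mul_comm ε]
  refine le_of_tendsto_of_tendsto hlim hlim' ?_
  filter_upwards [hN] with N hN
  refine abs_eulerPoint_sub_le (hpos N).le fun k hk => hJW ?_
  intro j hj
  refine hδW j ?_
  rw [Metric.mem_ball, Real.dist_eq]
  refine lt_of_le_of_lt ?_ (hN j hj)
  have h1 : |h N * ((k : ℝ) - a t N)| ≤ |h N * ((a s N : ℝ) - a t N)| := by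
    rw [abs_mul, abs_mul]
    refine mul_le_mul_of_nonneg_left ?_ (abs_nonneg _)
    rcases Set.mem_uIcc.1 hk with ⟨h1, h2⟩ | ⟨h1, h2⟩
    · have h1 : (a t N : ℝ) ≤ k := Nat.cast_le.2 h1
      have h2 : (k : ℝ) ≤ a s N := Nat.cast_le.2 h2
      rw [abs_of_nonneg (by linarith), abs_of_nonneg (by linarith)]
      linarith
    · have h1 : (a s N : ℝ) ≤ k := Nat.cast_le.2 h1
      have h2 : (k : ℝ) ≤ a t N := Nat.cast_le.2 h2
      rw [abs_of_nonpos (by linarith), abs_of_nonpos (by linarith)]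
      linarith
  have h2 := (hlip N (a t N) k j).trans (mul_le_mul_of_nonneg_right h1 (hC0 j))
  have h3 := abs_sub_le (U N k j) (U N (a t N) j) (x t j)
  linarith

/-! ### Global solutions in the two geometries -/

section

variable {V : Type*} {T : AbstractSimplicialComplex V} {Φ : Sym2 V → ℝ}

theorem exists_isSolution_euclidean (hT : ∀ i, {s : Finset V | s ∈ T ∧ i ∈ s}.Finite)
    (hΦ : ∀ e ∈ (oneSkeleton T).edgeSet, Φ e ∈ Set.Icc 0 (Real.pi / 2)) {r₀ : V → ℝ}
    (hr₀ : ∀ i, 0 < r₀ i) : ∃ r : ℝ → V → ℝ, IsSolution .euclidean T Φ r ∧ r 0 = r₀ := by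
  have hpos : ∀ (y : V → ℝ) j, 0 < Real.exp (y j) := fun y j => Real.exp_pos _
  choose C hC using fun i => exists_abs_curvature_le (hT i) .euclidean Φ
  obtain ⟨x, hx0, hx⟩ := exists_hasDerivWithinAt_of_continuous
    (G := fun y i => -curvature .euclidean T Φ (fun j => Real.exp (y j)) i) (C := C)
    (continuous_pi fun i => (continuous_curvature_comp (hT i) hΦ _ hpos (by fun_prop)).neg)
    (fun y i => by rw [abs_neg]; exact hC i _) fun i => Real.log (r₀ i)
  refine ⟨fun t i => Real.exp (x t i), ⟨fun t _ i => Real.exp_pos _, fun t ht i => ?_⟩, ?_⟩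
  · exact (hx t ht i).exp.congr_deriv (by simp only [flowFactor]; ring)
  · ext i
    simp [hx0, Real.exp_log (hr₀ i)]

/-- The coordinate `y = log (sinh r)` runs over all of `ℝ`, unlike `radCoord`, and satisfies `dy/dt
= -K * cosh r`. Cutting `y_j` off at `m j = log (sinh (R j))` makes each coordinate of the field
bounded. -/
theorem exists_isSolution_hyperbolic (hT : ∀ i, {s : Finset V | s ∈ T ∧ i ∈ s}.Finite)
    (hΦ : ∀ e ∈ (oneSkeleton T).edgeSet, Φ e ∈ Set.Icc 0 (Real.pi / 2)) {r₀ : V → ℝ}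
    (hr₀ : ∀ i, 0 < r₀ i) : ∃ r : ℝ → V → ℝ, IsSolution .hyperbolic T Φ r ∧ r 0 = r₀ := by
  choose C hC using fun i => exists_abs_curvature_le (hT i) .hyperbolic Φ
  choose R hR hRr using fun i =>
    ((eventually_curvature_pos (hT i) hΦ).and (Filter.eventually_ge_atTop (r₀ i))).exists
  have hRpos : ∀ i, 0 < R i := fun i => (hr₀ i).trans_le (hRr i)
  have hsR : ∀ i, 0 < Real.sinh (R i) := fun i => Real.sinh_pos_iff.2 (hRpos i)
  set m : V → ℝ := fun i => Real.log (Real.sinh (R i)) with hm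
  have hexpm : ∀ i, Real.arsinh (Real.exp (m i)) = R i := fun i => by
    rw [hm, Real.exp_log (hsR i), Real.arsinh_sinh]
  set ρ : (V → ℝ) → V → ℝ := fun y j => Real.arsinh (Real.exp (min (y j) (m j))) with hρ
  have hpos : ∀ y j, 0 < ρ y j := fun y j => Real.arsinh_pos_iff.2 (Real.exp_pos _)
  have hρR : ∀ y j, ρ y j ≤ R j := fun y j => by
    rw [← hexpm]
    exact Real.arsinh_le_arsinh.2 (Real.exp_le_exp.2 (min_le_right _ _))
  have hρc : Continuous ρ := continuous_pi fun j =>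
    Real.continuous_arsinh.comp (Real.continuous_exp.comp
      ((continuous_apply j).min continuous_const))
  obtain ⟨x, hx0, hx⟩ := exists_hasDerivWithinAt_of_continuous
    (G := fun y i => -curvature .hyperbolic T Φ (ρ y) i * Real.cosh (ρ y i))
    (C := fun i => C i * Real.cosh (R i))
    (continuous_pi fun i => (continuous_curvature_comp (hT i) hΦ _ hpos hρc).neg.mul
      (Real.continuous_cosh.comp ((continuous_apply i).comp hρc)))
    (fun y i => by
      rw [abs_mul, abs_neg, abs_of_pos (Real.cosh_pos _)]
      refine mul_le_mul (hC i _) ?_ (Real.cosh_pos _).le ((abs_nonneg _).trans (hC i r₀))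
      exact Real.cosh_le_cosh.2 (abs_le_abs_of_nonneg (hpos y i).le (hρR y i)))
    fun i => Real.log (Real.sinh (r₀ i))
  -- At `x t i = m i` the truncated radius at `i` is exactly `R i`, where the curvature is positive
  -- for any other radii. So `m i` is a barrier, the truncation is never active, and the flow itself
  -- is solved.
  have hxm : ∀ t, 0 ≤ t → ∀ i, x t i ≤ m i := fun t ht i => by
    refine image_le_of_deriv_right_lt_deriv_boundary (a := 0) (b := t) (f := fun s => x s i)
      (fun s hs => (hx s hs.1 i).continuousWithinAt.mono Set.Icc_subset_Ici_self)
      (fun s hs => (hx s hs.1 i).mono (Set.Ici_subset_Ici.2 hs.1)) ?_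
      (fun s => hasDerivAt_const s (m i)) (fun s hs he => ?_) ⟨ht, le_rfl⟩
    · rw [hx0]
      exact Real.log_le_log (Real.sinh_pos_iff.2 (hr₀ i)) (Real.sinh_le_sinh.2 (hRr i))
    · refine mul_neg_of_neg_of_pos (neg_neg_of_pos (hR i _ (hpos _) ?_)) (Real.cosh_pos _)
      simp only [hρ]
      rw [he, min_self, hexpm]
  have hρx : ∀ t, 0 ≤ t → ρ (x t) = fun i => Real.arsinh (Real.exp (x t i)) := fun t ht => by
    ext i
    simp only [hρ, min_eq_left (hxm t ht i)]
  refine ⟨fun t i => Real.arsinh (Real.exp (x t i)),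
    ⟨fun t _ i => Real.arsinh_pos_iff.2 (Real.exp_pos _), fun t ht i => ?_⟩, ?_⟩
  · have h1 := (hx t ht i).exp.arsinh
    rw [hρx t ht] at h1
    refine h1.congr_deriv ?_
    simp only [flowFactor, Real.sinh_arsinh, Real.cosh_arsinh, smul_eq_mul]
    have : √(1 + Real.exp (x t i) ^ 2) ≠ 0 := (Real.sqrt_pos.2 (by positivity)).ne'
    field_simp
  · ext i
    simp [hx0, Real.exp_log (Real.sinh_pos_iff.2 (hr₀ i))]

end

end CombinatorialRicciFlow

open CombinatorialRicciFlow in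
theorem theorem1p1 {V : Type*} [Infinite V] (T : AbstractSimplicialComplex V)
    (hT : IsDiskTriangulation T) (Φ : Sym2 V → ℝ)
    (hΦ : ∀ e ∈ (oneSkeleton T).edgeSet, Φ e ∈ Set.Icc 0 (Real.pi / 2))
    (g : Background) (r₀ : V → ℝ) (hr₀ : ∀ i, 0 < r₀ i) :
    (∃ r : ℝ → V → ℝ, IsSolution g T Φ r ∧ r 0 = r₀) ∧
    (∀ r r' : ℝ → V → ℝ, IsSolution g T Φ r → IsSolution g T Φ r' →
      r 0 = r₀ → r' 0 = r₀ → BoundedCurvature g T Φ r → BoundedCurvature g T Φ r' →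
      ∀ t, 0 ≤ t → r t = r' t) := by
  refine ⟨?_, fun r r' hr hr' h0 h0' hb hb' t ht =>
    hr.eq_of_boundedCurvature hT.locallyFinite hΦ hr' (h0.trans h0'.symm) hb hb' ht⟩
  cases g
  · exact exists_isSolution_euclidean hT.locallyFinite hΦ hr₀
  · exact exists_isSolution_hyperbolic hT.locallyFinite hΦ hr₀
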